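/- **Setting.** Let $E$ be $\mathbb{R}^n$ with an arbitrary norm $\|\cdot\|$ and dual norm $\|\cdot\|_*$, let $X\subseteq E$ be closed and convex, let $f_1,\dots,f_m:E\to\mathbb{R}$ be convex and differentiable with $\|\nabla f_i(x)-\nabla f_i(x')\|_*\le L_i\|x-x'\|$ on $E$, $L_i\ge 0$, $L:=\sum_i L_i>0$, and let $0\le L_f\le L$ be such that $\nabla f$, $f:=\sum_i f_i$, is $L_f$-Lipschitz. Let $h:X\to\mathbb{R}$ be convex and let $\omega:X\to\mathbb{R}$ be strongly convex with modulus $1$ with respect to $\|\cdot\|$, such that $\langle g,\cdot\rangle+h+\gamma\omega$ attains its minimum on $X$ for all linear $g$ and all $\gamma>0$. Subdifferentials of $h,\omega$ are those of their extensions by $+\infty$ outside $X$. For $\omega'(x_0)\in\partial\omega(x_0)$ put $P(x_0,x):=\omega(x)-\omega(x_0)-\langle\omega'(x_0),x-x_0\rangle$. Let $\mu=0$, so that the problem is $\Psi^*:=\inf_{x\in X}\Psi(x)$ with $\Psi:=f+h$. Fix $x_0\in X$, $\omega'(x_0)\in\partial\omega(x_0)$ and $\Omega_X>0$ with $P(x_0,x)\le\Omega_X^2$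 for all $x\in X$. For $\varepsilon>0$ put $\delta:=\varepsilon/(2\Omega_X^2)$. **Algorithm (RPDG applied to $\min_X f+h+\delta P(x_0,\cdot)$).** This problem is $\min_X f+\tilde h+\delta\omega$ with $\tilde h(x):=h(x)-\delta[\omega(x_0)+\langle\omega'(x_0),x-x_0\rangle]$. With $C:=8L/\delta$ and $S:=\sqrt{(m-1)^2+4mC}$ set $$p_i=\tfrac1{2m}+\tfrac{L_i}{2L},\quad \tau=\tfrac{S-(m-1)}{2m},\quad \eta=\tfrac{\delta S+\delta(m-1)}{2},\quad \alpha=1-\tfrac{1}{(m+1)+S}.$$ Let $J_i$ be the conjugate of $f_i$ and $D_i(y^0,y):=J_i(y)-J_i(y^0)-\langle J_i'(y^0),y-y^0\rangle$. Start with $x^0=x^{-1}=x_0$, $y_i^0=\nabla f_i(x_0)$, $J_i'(y_i^0)=x_0$. At iteration $t=1,2,\dots$ draw $i_t$, independently of the past, with $\mathrm{Prob}\{i_t=i\}=p_i$; put $\tilde x^t=\alpha(x^{t-1}-x^{t-2})+x^{t-1}$; for $i=i_t$ let $$y_i^t\in\operatorname{argmin}_{y}\{-\langle\tilde x^t,y\rangle+J_i(y)+\tau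 D_i(y_i^{t-1},y)\},\quad J_i'(y_i^t)=\frac{\tilde x^t+\tau J_i'(y_i^{t-1})}{1+\tau},\quad \tilde y_i^t=p_i^{-1}(y_i^t-y_i^{t-1})+y_i^{t-1};$$ for $i\ne i_t$ let $y_i^t=\tilde y_i^t=y_i^{t-1}$ and keep $J_i'$; finally let $$x^t\in\operatorname{argmin}_{x\in X}\{\langle\textstyle\sum_i\tilde y_i^t,x\rangle+\tilde h(x)+\delta\omega(x)+\eta P(x^{t-1},x)\},$$ and select, depending on $i_1,\dots,i_t$ only, $\omega'(x^t)\in\partial\omega(x^t)$ such that for some $\tilde h'(x^t)\in\partial\tilde h(x^t)$ one has $\langle\sum_i\tilde y_i^t+\tilde h'(x^t)+(\delta+\eta)\omega'(x^t)-\eta\omega'(x^{t-1}),x-x^t\rangle\ge0$ for all $x\in X$. The output after $k$ iterations is $\bar x^k=(\sum_{t=1}^k\alpha^{-t})^{-1}\sum_{t=1}^k\alpha^{-t}x^t$. **Proposition.** There is a universal constant $c>0$ such that in every such setting, for every $\varepsilon>0$, the algorithm can be executed, and every execution of it has the following properties for every integer $K\ge0$. Put $$B:=\max\Big\{2,\ \Omega_X,\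 \frac{mL_f\Omega_X}{\varepsilon}\Big\}.$$ 1. If $K\ge c\left(m+\sqrt{\tfrac{mL\Omega_X^2}{\varepsilon}}\right)\log B$, then $\bar x^K\in X$ and $\mathbb{E}[\Psi(\bar x^K)-\Psi^*]\le\varepsilon$ (the expectation being well defined). 2. If $\lambda\in(0,1)$ and $K\ge c\left(m+\sqrt{\tfrac{mL\Omega_X^2}{\varepsilon}}\right)\log\tfrac{B}{\lambda}$, then $\bar x^K\in X$ and $\mathrm{Prob}\{\Psi(\bar x^K)-\Psi^*>\varepsilon\}\le\lambda$. In particular, as soon as $\varepsilon\le mL_f$ and $2\varepsilon\le mL_f\Omega_X$, the iteration bounds are ${\cal O}\{(m+\sqrt{mL\Omega_X^2/\varepsilon})\log\frac{mL_f\Omega_X}{\varepsilon}\}$ and ${\cal O}\{(m+\sqrt{mL\Omega_X^2/\varepsilon})\log\frac{mL_f\Omega_X}{\lambda\varepsilon}\}$ with a universal constant. -/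

import Mathlib

open MeasureTheory ProbabilityTheory

namespace RPDG

noncomputable section

variable {E : Type*} [NormedAddCommGroup E] [NormedSpace ℝ E] {m : ℕ}

/-- The objective `Ψ(x) = ∑ i, f i x + h x + μ * ω x` of the convex program. -/
def objective (f : Fin m → E → ℝ) (h ω : E → ℝ) (μ : ℝ) (x : E) : ℝ :=
  ∑ i, f i x + h x + μ * ω x

/-- The subdifferential at `x` of `φ : X → ℝ` (that is, of `φ` extended by `+∞` outside `X`). -/
def subdiffOn (X : Set E) (φ : E → ℝ) (x : E) : Set (E →L[ℝ] ℝ) :=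
  {s | ∀ u ∈ X, φ x + s (u - x) ≤ φ u}

/-- The primal prox-function (Bregman distance) `P(x₀, x)` of `ω`, where `s` is the selected
subgradient `ω'(x₀)`. -/
def bregman (ω : E → ℝ) (s : E →L[ℝ] ℝ) (x₀ x : E) : ℝ :=
  ω x - (ω x₀ + s (x - x₀))

/-- The effective domain of the conjugate of `φ`. -/
def dualDomain (φ : E → ℝ) : Set (E →L[ℝ] ℝ) :=
  {y | BddAbove (Set.range fun x => y x - φ x)}

/-- The conjugate `J(y) = sup_x (⟨y, x⟩ - φ x)`, meaningful for `y ∈ dualDomain φ`. -/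
def conj (φ : E → ℝ) (y : E →L[ℝ] ℝ) : ℝ :=
  ⨆ x, (y x - φ x)

/-- The dual prox-function `D(y₀, y)` of the conjugate `J` of `φ`, where `z` is the selected
subgradient `J'(y₀)`. -/
def dualBregman (φ : E → ℝ) (z : E) (y₀ y : E →L[ℝ] ℝ) : ℝ :=
  conj φ y - (conj φ y₀ + (y - y₀) z)

/-- `y` is the value of the dual prox-mapping: it minimizes
`⟨-x', v⟩ + J(v) + τ * D(y₀, v)` over the domain of `J`. -/
def IsDualProx (φ : E → ℝ) (x' z : E) (y₀ : E →L[ℝ] ℝ) (τ : ℝ) (y : E →L[ℝ] ℝ) : Prop :=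
  y ∈ dualDomain φ ∧
    IsMinOn (fun v : E →L[ℝ] ℝ => -v x' + conj φ v + τ * dualBregman φ z y₀ v) (dualDomain φ) y

/-- `x₁` is the value of the primal prox-mapping: it minimizes
`⟨g, u⟩ + h u + μ * ω u + η * P(x₀, u)` over `X`, where `s₀` is the selected subgradient of `ω` at
`x₀`; and `s₁` is an admissible selection of the subgradient of `ω` at `x₁`: together with some
subgradient `d` of `h` at `x₁` it satisfies the optimality condition that
`-(g + d + (μ + η) * s₁ - η * s₀)` lies in the normal cone of `X` at `x₁`. -/
structure IsPrimalProx (X : Set E) (h ω : E → ℝ) (μ η : ℝ) (g : E →L[ℝ] ℝ)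
    (x₀ : E) (s₀ : E →L[ℝ] ℝ) (x₁ : E) (s₁ : E →L[ℝ] ℝ) : Prop where
  mem : x₁ ∈ X
  isMinOn : IsMinOn (fun u => g u + h u + μ * ω u + η * bregman ω s₀ x₀ u) X x₁
  subgradient : s₁ ∈ subdiffOn X ω x₁
  optimality : ∃ d ∈ subdiffOn X h x₁,
    ∀ u ∈ X, 0 ≤ (g + d + (μ + η) • s₁ - η • s₀) (u - x₁)

/-- The state of the method after `t` iterations: `x = xᵗ`, `xPrev = xᵗ⁻¹`, the selected
subgradient `s = ω'(xᵗ)`, the dual points `y i = yᵢᵗ` and the selected subgradients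
`z i = Jᵢ'(yᵢᵗ)` of the conjugates. -/
@[ext] structure State (E : Type*) [NormedAddCommGroup E] [NormedSpace ℝ E] (m : ℕ) where
  x : E
  xPrev : E
  s : E →L[ℝ] ℝ
  y : Fin m → (E →L[ℝ] ℝ)
  z : Fin m → E

/-- The initial state: `x⁰ = x⁻¹ = x₀`, `yᵢ⁰ = ∇fᵢ(x₀)` and `Jᵢ'(yᵢ⁰) = x₀`. -/
def initialState (f : Fin m → E → ℝ) (x₀ : E) (s₀ : E →L[ℝ] ℝ) : State E m where
  x := x₀
  xPrev := x₀
  s := s₀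
  y := fun i => fderiv ℝ (f i) x₀
  z := fun _ => x₀

/-- The primal prediction `x̃ = α (xᵗ⁻¹ - xᵗ⁻²) + xᵗ⁻¹`. -/
def predict (α : ℝ) (S : State E m) : E := α • (S.x - S.xPrev) + S.x

/-- One iteration of the randomized primal-dual gradient method, for the problem of minimizing
`objective f h ω μ` over `X`, in which the block `i` was drawn (with probability `p i`). -/
structure IsStep (X : Set E) (f : Fin m → E → ℝ) (h ω : E → ℝ) (μ : ℝ) (p : Fin m → ℝ)
    (τ η α : ℝ) (i : Fin m) (S S' : State E m) : Prop where
  xPrev_eq : S'.xPrev = S.x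
  dual_prox : IsDualProx (f i) (predict α S) (S.z i) (S.y i) τ (S'.y i)
  dual_frozen : ∀ j, j ≠ i → S'.y j = S.y j
  selection : S'.z i = (1 + τ)⁻¹ • (predict α S + τ • S.z i)
  selection_frozen : ∀ j, j ≠ i → S'.z j = S.z j
  /-- The primal step uses the dual prediction: `p i⁻¹ (yᵢᵗ - yᵢᵗ⁻¹) + yᵢᵗ⁻¹` in block `i` and
  `yⱼᵗ⁻¹` in the other blocks. -/
  primal_prox : IsPrimalProx X h ω μ η
    (∑ j, if j = i then (p j)⁻¹ • (S'.y j - S.y j) + S.y j else S.y j) S.x S.s S'.x S'.s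

/-- An execution of the randomized primal-dual gradient method. It assigns to every sequence `ξ`
of drawn blocks (`ξ t` is the block of iteration `t + 1`) the states of the method; the state
after `t` iterations depends on the first `t` draws only. (The selection of the subgradients of
`ω` is the only freedom left, as the prox-mappings are single-valued.) -/
structure Execution (X : Set E) (f : Fin m → E → ℝ) (h ω : E → ℝ) (μ : ℝ) (p : Fin m → ℝ)
    (τ η α : ℕ → ℝ) (x₀ : E) (s₀ : E →L[ℝ] ℝ) where
  state : ℕ → (ℕ → Fin m) → State E m
  initial : ∀ ξ, state 0 ξ = initialState f x₀ s₀
  step : ∀ t ξ, IsStep X f h ω μ p (τ (t + 1)) (η (t + 1)) (α (t + 1)) (ξ t)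
    (state t ξ) (state (t + 1) ξ)
  nonanticipating : ∀ t ξ ξ', (∀ r < t, ξ r = ξ' r) → state t ξ = state t ξ'

/-- The output `x̄ᵏ = (∑ θ t)⁻¹ ∑ θ t xᵗ` (sums over `t = 1, …, k`) for weights `θ`. -/
def Execution.average {X : Set E} {f : Fin m → E → ℝ} {h ω : E → ℝ} {μ : ℝ} {p : Fin m → ℝ}
    {τ η α : ℕ → ℝ} {x₀ : E} {s₀ : E →L[ℝ] ℝ} (A : Execution X f h ω μ p τ η α x₀ s₀)
    (θ : ℕ → ℝ) (k : ℕ) (ξ : ℕ → Fin m) : E :=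
  (∑ t ∈ Finset.Icc 1 k, θ t)⁻¹ • ∑ t ∈ Finset.Icc 1 k, θ t • (A.state t ξ).x

/-! Parameters of the method for modulus `μ` and Lipschitz constants `L i`. -/

/-- The non-uniform probabilities `p i = 1 / (2 m) + L i / (2 ∑ L)`. -/
def prob (L : Fin m → ℝ) (i : Fin m) : ℝ := 1 / (2 * (m : ℝ)) + L i / (2 * ∑ j, L j)

/-- `√((m - 1)² + 4 m C)` with `C = 8 ∑ L / μ`. -/
def root (μ : ℝ) (L : Fin m → ℝ) : ℝ :=
  Real.sqrt (((m : ℝ) - 1) ^ 2 + 4 * (m : ℝ) * (8 * (∑ j, L j) / μ))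

def tau (μ : ℝ) (L : Fin m → ℝ) : ℝ := (root μ L - ((m : ℝ) - 1)) / (2 * (m : ℝ))

def eta (μ : ℝ) (L : Fin m → ℝ) : ℝ := (μ * root μ L + μ * ((m : ℝ) - 1)) / 2

def alpha (μ : ℝ) (L : Fin m → ℝ) : ℝ := 1 - 1 / (((m : ℝ) + 1) + root μ L)

/-- The simple term of the perturbed problem, see `objective_perturbed`. -/
def perturbed (h ω : E → ℝ) (δ : ℝ) (x₀ : E) (s₀ : E →L[ℝ] ℝ) (x : E) : ℝ :=
  h x - δ * (ω x₀ + s₀ (x - x₀))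

/-- The perturbed problem `f + h + δ P(x₀, ·)` is a convex program of the original form, with
modulus `δ` and with `perturbed h ω δ x₀ s₀` as its simple term. -/
theorem objective_perturbed (f : Fin m → E → ℝ) (h ω : E → ℝ) (δ : ℝ) (x₀ : E)
    (s₀ : E →L[ℝ] ℝ) (x : E) :
    objective f (perturbed h ω δ x₀ s₀) ω δ x =
      ∑ i, f i x + h x + δ * bregman ω s₀ x₀ x := by
  simp only [objective, perturbed, bregman]
  ring

/-- An execution, from the starting point `x₀`, of the method applied to the perturbed problem,
with the constant parameters of the strongly convex case for the modulus `δ`. -/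
abbrev PerturbedExecution (X : Set E) (f : Fin m → E → ℝ) (h ω : E → ℝ) (L : Fin m → ℝ)
    (δ : ℝ) (x₀ : E) (s₀ : E →L[ℝ] ℝ) :=
  Execution X f (perturbed h ω δ x₀ s₀) ω δ (prob L)
    (fun _ => tau δ L) (fun _ => eta δ L) (fun _ => alpha δ L) x₀ s₀

/-- The output after `k` iterations, with the weights `θ t = α⁻ᵗ`. -/
def PerturbedExecution.output {X : Set E} {f : Fin m → E → ℝ} {h ω : E → ℝ} {L : Fin m → ℝ}
    {δ : ℝ} {x₀ : E} {s₀ : E →L[ℝ] ℝ} (A : PerturbedExecution X f h ω L δ x₀ s₀)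
    (k : ℕ) (ξ : ℕ → Fin m) : E :=
  A.average (fun t => 1 / alpha δ L ^ t) k ξ

end

end RPDG

/-! Adding `δ P(x₀, ·)` with `δ = ε / (2 R²)` makes the problem strongly convex and raises its
values on `X` by at most `ε / 2`. It therefore suffices to bring the expected gap of the perturbed
problem below `ε / 2` for the first claim, and below `λ ε / 2` for the second, which then follows
from Markov's inequality.

The equality case of Fenchel's inequality (`isDualProx_iff`) turns the dual prox-step into a
gradient evaluation: `yᵢ = ∇fᵢ(zᵢ)` along every execution. The dual distance `Dᵢ(∇fᵢ(b), ∇fᵢ(a))` is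
then `linGap (f i) a b`, and the conjugates drop out of the analysis.

The function `lyapunov` combines the primal distance to a point `u`, the dual distances weighted by
`1 / pᵢ`, and a cross term with the last displacement. Averaging one step over the drawn block gives
`E[V' + gap] ≤ α V` (`sum_prob_mul_lyapunov_le`), where `gap` belongs to the problem with `f`
linearized at `u`. It is nonnegative because `u` is chosen to solve its own linearized problem
(`exists_linearized_min`). The weights `α⁻ᵗ` make the recursion telescope.

The true gap exceeds the linearized one by at most `Lf / 2 ‖x - u‖²`, hence by at most `Lf V / (μ +
η)`. As `E V` decays like `αᵗ`, this costs the weighted sum only a factor linear in `K`, which half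
of the exponential decay absorbs (`average_bound`). A multiple of `(1 - α)⁻¹ log (B / λ)` iterations
then beats the polynomial error constant (`error_bound`).

Executability rests on a subdifferential sum rule (`exists_linear_between`) that needs no constraint
qualification, because `h` and `ω` share the domain `X`. -/

namespace RPDG

/-! ### Smooth and strongly convex functions: quadratic models, linearization gaps. -/

section ConvexAnalysis

variable {E : Type*} [NormedAddCommGroup E] [NormedSpace ℝ E]

/-- Stands in for the limit `t → 0⁺` after a convexity inequality along a segment has been divided
by `t`. -/
theorem le_of_forall_le_add_mul {a b c : ℝ} (H : ∀ t : ℝ, 0 < t → t ≤ 1 → a ≤ b + t * c) :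
    a ≤ b := by
  by_contra! hab
  have hd : 0 < a - b := by linarith
  have hc : 0 < |c| + 1 := by positivity
  have h1 := H (min 1 ((a - b) / (2 * (|c| + 1)))) (by positivity) (min_le_left _ _)
  have h2 : min 1 ((a - b) / (2 * (|c| + 1))) * c ≤ (a - b) / (2 * (|c| + 1)) * (|c| + 1) :=
    calc _ ≤ min 1 ((a - b) / (2 * (|c| + 1))) * (|c| + 1) := by
          apply mul_le_mul_of_nonneg_left _ (by positivity)
          linarith [le_abs_self c]
      _ ≤ _ := by
          apply mul_le_mul_of_nonneg_right (min_le_right _ _) hc.le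
  have h3 : (a - b) / (2 * (|c| + 1)) * (|c| + 1) = (a - b) / 2 := by
    field_simp
  linarith

/-- A function with Lipschitz derivative is bounded above by its quadratic model. -/
theorem le_quadratic_model {f : E → ℝ} {L : ℝ} (hd : Differentiable ℝ f)
    (hL : ∀ x x', ‖fderiv ℝ f x - fderiv ℝ f x'‖ ≤ L * ‖x - x'‖) (u v : E) :
    f v ≤ f u + fderiv ℝ f u (v - u) + L / 2 * ‖v - u‖ ^ 2 := by
  set d := v - u with hdef
  let g : ℝ → ℝ := fun t => f (u + t • d) - t * fderiv ℝ f u d - L / 2 * t ^ 2 * ‖d‖ ^ 2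
  have hg : ∀ t : ℝ, HasDerivAt g
      (fderiv ℝ f (u + t • d) d - fderiv ℝ f u d - L * t * ‖d‖ ^ 2) t := by
    intro t
    have h1 : HasDerivAt (fun t : ℝ => u + t • d) d t := by
      simpa using ((hasDerivAt_id t).smul_const d).const_add u
    have h2 := (hd (u + t • d)).hasFDerivAt.comp_hasDerivAt t h1
    have h3 : HasDerivAt (fun t : ℝ => t * fderiv ℝ f u d) (fderiv ℝ f u d) t := by
      simpa using (hasDerivAt_id t).mul_const (fderiv ℝ f u d)
    have h4 : HasDerivAt (fun t : ℝ => L / 2 * t ^ 2 * ‖d‖ ^ 2) (L * t * ‖d‖ ^ 2) t := by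
      have := (((hasDerivAt_id t).pow 2).const_mul (L / 2)).mul_const (‖d‖ ^ 2)
      refine this.congr_deriv ?_
      change L / 2 * (((2 : ℕ) : ℝ) * t ^ (2 - 1) * 1) * ‖d‖ ^ 2 = _
      push_cast
      ring
    exact (h2.sub h3).sub h4
  have hanti : AntitoneOn g (Set.Icc 0 1) := by
    apply antitoneOn_of_deriv_nonpos (convex_Icc 0 1)
    · exact fun t _ => (hg t).continuousAt.continuousWithinAt
    · exact fun t _ => (hg t).differentiableAt.differentiableWithinAt
    · intro t ht
      rw [interior_Icc] at ht
      rw [(hg t).deriv]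
      have h1 : (fderiv ℝ f (u + t • d) - fderiv ℝ f u) d ≤ L * t * ‖d‖ * ‖d‖ := by
        refine (le_abs_self _).trans ?_
        rw [← Real.norm_eq_abs]
        refine (ContinuousLinearMap.le_opNorm _ d).trans ?_
        apply mul_le_mul_of_nonneg_right _ (norm_nonneg d)
        refine (hL _ _).trans (le_of_eq ?_)
        rw [add_sub_cancel_left, norm_smul, Real.norm_of_nonneg ht.1.le]
        ring
      simp only [sub_apply] at h1
      linarith
  have h := hanti (by simp : (0 : ℝ) ∈ Set.Icc (0 : ℝ) 1) (by simp : (1 : ℝ) ∈ Set.Icc (0 : ℝ) 1)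
    zero_le_one
  have hv : u + d = v := by simp [hdef]
  simp only [g, one_smul, zero_smul, hv] at h
  simp at h
  linarith

/-- A function with Lipschitz derivative is bounded below by its quadratic model. -/
theorem quadratic_model_le {f : E → ℝ} {L : ℝ} (hd : Differentiable ℝ f)
    (hL : ∀ x x', ‖fderiv ℝ f x - fderiv ℝ f x'‖ ≤ L * ‖x - x'‖) (u v : E) :
    f u + fderiv ℝ f u (v - u) - L / 2 * ‖v - u‖ ^ 2 ≤ f v := by
  have hneg : ∀ x, fderiv ℝ (fun y => - f y) x = - fderiv ℝ f x := fun x => fderiv_fun_neg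
  have h := le_quadratic_model (f := fun y => - f y) (L := L) hd.neg (fun x x' => by
    rw [hneg, hneg, ← neg_sub', norm_neg]; exact hL x x') u v
  rw [hneg] at h
  simp only [neg_apply] at h
  linarith

/-- The gap `φ b - φ a - φ'(a) (b - a)` between `φ` and its linearization at `a`. -/
noncomputable def linGap (φ : E → ℝ) (a b : E) : ℝ := φ b - φ a - fderiv ℝ φ a (b - a)

theorem linGap_nonneg {f : E → ℝ} (hf : ConvexOn ℝ Set.univ f) (hd : Differentiable ℝ f)
    {L : ℝ} (hL : ∀ x x', ‖fderiv ℝ f x - fderiv ℝ f x'‖ ≤ L * ‖x - x'‖) (a b : E) :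
    0 ≤ linGap f a b := by
  have key : f a + fderiv ℝ f a (b - a) ≤ f b := by
    apply le_of_forall_le_add_mul (c := L / 2 * ‖b - a‖ ^ 2)
    intro t ht ht1
    have h1 := hf.2 (Set.mem_univ a) (Set.mem_univ b) (by linarith : 0 ≤ 1 - t) ht.le (by ring)
    have h2 := quadratic_model_le hd hL a ((1 - t) • a + t • b)
    have h3 : (1 - t) • a + t • b - a = t • (b - a) := by module
    rw [h3, map_smul, norm_smul, Real.norm_of_nonneg ht.le] at h2
    simp only [smul_eq_mul] at h1 h2
    have h4 : t * (f a + fderiv ℝ f a (b - a)) ≤ t * (f b + t * (L / 2 * ‖b - a‖ ^ 2)) := by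
      nlinarith
    exact le_of_mul_le_mul_left h4 ht
  unfold linGap
  linarith

theorem linGap_le {f : E → ℝ} (hd : Differentiable ℝ f)
    {L : ℝ} (hL : ∀ x x', ‖fderiv ℝ f x - fderiv ℝ f x'‖ ≤ L * ‖x - x'‖) (a b : E) :
    linGap f a b ≤ L / 2 * ‖b - a‖ ^ 2 := by
  have := le_quadratic_model hd hL a b
  unfold linGap
  linarith

/-- Co-coercivity of the derivative, in the form in which it enters weighted estimates. -/
theorem fderiv_sub_apply_le {f : E → ℝ} (hf : ConvexOn ℝ Set.univ f) (hd : Differentiable ℝ f)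
    {L : ℝ} (hL : ∀ x x', ‖fderiv ℝ f x - fderiv ℝ f x'‖ ≤ L * ‖x - x'‖) (a b d : E)
    {r : ℝ} (hr : 0 < r) :
    (fderiv ℝ f b - fderiv ℝ f a) d ≤ r * linGap f a b + L / (2 * r) * ‖d‖ ^ 2 := by
  -- The point `b - r⁻¹ d` is compared from above with the quadratic model at `b` and from below
  -- with the tangent at `a`; multiplying by `r` gives the claim.
  have h1 := le_quadratic_model hd hL b (b - r⁻¹ • d)
  have h2 := linGap_nonneg hf hd hL a (b - r⁻¹ • d)
  unfold linGap at h2 ⊢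
  have h3 : b - r⁻¹ • d - b = -(r⁻¹ • d) := by abel
  have h4 : b - r⁻¹ • d - a = (b - a) - r⁻¹ • d := by abel
  rw [h3, map_neg, map_smul, norm_neg, norm_smul, Real.norm_of_nonneg (by positivity)] at h1
  rw [h4, map_sub, map_smul] at h2
  simp only [smul_eq_mul] at h1 h2
  simp only [sub_apply]
  have h5 : r⁻¹ * (fderiv ℝ f b d - fderiv ℝ f a d) ≤
      (f b - f a - fderiv ℝ f a (b - a)) + L / 2 * (r⁻¹ * ‖d‖) ^ 2 := by linarith
  have h6 := mul_le_mul_of_nonneg_left h5 hr.le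
  have h7 : r * (r⁻¹ * (fderiv ℝ f b d - fderiv ℝ f a d)) = fderiv ℝ f b d - fderiv ℝ f a d := by
    field_simp
  have h8 : r * (L / 2 * (r⁻¹ * ‖d‖) ^ 2) = L / (2 * r) * ‖d‖ ^ 2 := by
    field_simp
  rw [h7, mul_add, h8] at h6
  exact h6

/-- A strongly convex function grows quadratically above its affine minorants. -/
theorem bregman_ge {X : Set E} {G : E → ℝ} {γ : ℝ} (hG : StrongConvexOn X γ G) {x u : E}
    {s : E →L[ℝ] ℝ} (hx : x ∈ X) (hs : s ∈ subdiffOn X G x) (hu : u ∈ X) :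
    γ / 2 * ‖u - x‖ ^ 2 ≤ bregman G s x u := by
  apply le_of_forall_le_add_mul (c := γ / 2 * ‖u - x‖ ^ 2)
  intro t ht ht1
  have h1 := hG.2 hx hu (by linarith : 0 ≤ 1 - t) ht.le (by ring)
  have h2 := hs _ (hG.1 hx hu (by linarith : 0 ≤ 1 - t) ht.le (by ring))
  have h3 : (1 - t) • x + t • u - x = t • (u - x) := by module
  rw [h3, map_smul] at h2
  rw [norm_sub_rev] at h1
  simp only [smul_eq_mul] at h1 h2
  unfold bregman
  have h4 : t * (γ / 2 * ‖u - x‖ ^ 2) ≤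
      t * (G u - (G x + s (u - x)) + t * (γ / 2 * ‖u - x‖ ^ 2)) := by nlinarith
  exact le_of_mul_le_mul_left h4 ht

theorem bregman_nonneg {X : Set E} {G : E → ℝ} {x u : E} {s : E →L[ℝ] ℝ}
    (hs : s ∈ subdiffOn X G x) (hu : u ∈ X) : 0 ≤ bregman G s x u := by
  have := hs u hu
  unfold bregman
  linarith

end ConvexAnalysis

/-! ### A sandwich theorem for convex functions with a common domain. -/

section SumRule

variable {V : Type*} [AddCommGroup V] [Module ℝ V]

theorem exists_cone_add {X : Set V} {F : V → ℝ} (hF : ConvexOn ℝ X F) (x : V) {u u' : V}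
    (hu : u ∈ X) (hu' : u' ∈ X) {a a' : ℝ} (ha : 0 ≤ a) (ha' : 0 ≤ a') :
    ∃ w ∈ X, a • (u - x) + a' • (u' - x) = (a + a') • (w - x) ∧
      (a + a') * F w ≤ a * F u + a' * F u' := by
  rcases (add_nonneg ha ha').eq_or_lt with h0 | h0
  · have h1 : a = 0 := by linarith
    have h2 : a' = 0 := by linarith
    exact ⟨u, hu, by simp [h1, h2], by simp [h1, h2]⟩
  · have e : a / (a + a') + a' / (a + a') = 1 := by field_simp
    have p1 : 0 ≤ a / (a + a') := by positivity
    have p2 : 0 ≤ a' / (a + a') := by positivity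
    refine ⟨(a / (a + a')) • u + (a' / (a + a')) • u', hF.1 hu hu' p1 p2 e, ?_, ?_⟩
    · have : x = (a / (a + a')) • x + (a' / (a + a')) • x := by rw [← add_smul, e, one_smul]
      have h3 : (a / (a + a')) • u + (a' / (a + a')) • u' - x =
          (a / (a + a')) • (u - x) + (a' / (a + a')) • (u' - x) := by
        conv_lhs => rw [this]
        module
      rw [h3, smul_add, smul_smul, smul_smul, mul_div_cancel₀ _ h0.ne', mul_div_cancel₀ _ h0.ne']
    · have h4 := mul_le_mul_of_nonneg_left (hF.2 hu hu' p1 p2 e) h0.le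
      simp only [smul_eq_mul] at h4
      refine h4.trans (le_of_eq ?_)
      field_simp

/-- Since `b ≤ a`, the point `u` lies on the segment from `x` to `v`, so convexity and `G x = 0`
give `a G(u) ≤ b G(v)`; now use `F u ≥ -G u`. -/
theorem cone_nonneg {X : Set V} {F G : V → ℝ} (hG : ConvexOn ℝ X G) {x : V}
    (hx : x ∈ X) (hG0 : G x = 0) (hFG : ∀ u ∈ X, 0 ≤ F u + G u) {u v : V}
    (hu : u ∈ X) (hv : v ∈ X) {a b : ℝ} (hb : 0 ≤ b) (hba : b ≤ a)
    (h : a • (u - x) = b • (v - x)) : 0 ≤ a * F u + b * G v := by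
  rcases (hb.trans hba).eq_or_lt with h0 | h0
  · have h1 : a = 0 := h0.symm
    have h2 : b = 0 := by linarith
    simp [h1, h2]
  · have hu' : u = (1 - b / a) • x + (b / a) • v := by
      have h1 : u - x = (b / a) • (v - x) := by
        rw [div_eq_inv_mul, mul_smul, ← h, smul_smul, inv_mul_cancel₀ h0.ne', one_smul]
      rw [← sub_eq_zero] at h1 ⊢
      rw [← h1]
      module
    have h2 := hG.2 hx hv (by rw [sub_nonneg]; exact (div_le_one h0).2 hba : 0 ≤ 1 - b / a)
      (by positivity : 0 ≤ b / a) (by ring)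
    rw [← hu', hG0] at h2
    simp only [smul_eq_mul, mul_zero, zero_add] at h2
    have h3 := mul_le_mul_of_nonneg_left h2 h0.le
    have h4 : a * (b / a * G v) = b * G v := by field_simp
    nlinarith [hFG u hu]

/-- A linear functional separates a convex function from a concave one below it, when the two
have the same domain and touch at a point. -/
theorem exists_linear_between {X : Set V} {F G : V → ℝ} (hF : ConvexOn ℝ X F)
    (hG : ConvexOn ℝ X G) {x : V} (hx : x ∈ X) (hF0 : F x = 0) (hG0 : G x = 0)
    (hFG : ∀ u ∈ X, 0 ≤ F u + G u) :
    ∃ l : V →ₗ[ℝ] ℝ, (∀ u ∈ X, l (u - x) ≤ F u) ∧ ∀ u ∈ X, - l (u - x) ≤ G u := by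
  -- The cone generated by the epigraph of `F` shifted to `x` and by the reflected epigraph of `G`.
  -- A functional nonnegative on it, normalized to be `r` on `(0, r)`, encodes both required
  -- inequalities.
  let C : PointedCone ℝ (V × ℝ) :=
    { carrier := {q | ∃ a b : ℝ, 0 ≤ a ∧ 0 ≤ b ∧ ∃ u ∈ X, ∃ v ∈ X,
        q.1 = a • (u - x) - b • (v - x) ∧ a * F u + b * G v ≤ q.2}
      zero_mem' := ⟨0, 0, le_rfl, le_rfl, x, hx, x, hx, by simp, by simp⟩
      add_mem' := by
        rintro q q' ⟨a, b, ha, hb, u, hu, v, hv, h1, h2⟩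
          ⟨a', b', ha', hb', u', hu', v', hv', h1', h2'⟩
        obtain ⟨w, hw, e1, e2⟩ := exists_cone_add hF x hu hu' ha ha'
        obtain ⟨z, hz, e3, e4⟩ := exists_cone_add hG x hv hv' hb hb'
        refine ⟨a + a', b + b', by positivity, by positivity, w, hw, z, hz, ?_, ?_⟩
        · rw [Prod.fst_add, h1, h1', ← e1, ← e3]; abel
        · rw [Prod.snd_add]; linarith
      smul_mem' := by
        rintro ⟨c, hc⟩ q ⟨a, b, ha, hb, u, hu, v, hv, h1, h2⟩
        refine ⟨c * a, c * b, by positivity, by positivity, u, hu, v, hv, ?_, ?_⟩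
        · change c • q.1 = _
          rw [h1]; module
        · change _ ≤ c • q.2
          rw [smul_eq_mul]
          nlinarith [mul_le_mul_of_nonneg_left h2 hc] }
  let U : Submodule ℝ V := Submodule.span ℝ ((fun u => u - x) '' X)
  have hU : ∀ d ∈ U, ∃ a b : ℝ, 0 ≤ a ∧ 0 ≤ b ∧ ∃ u ∈ X, ∃ v ∈ X,
      d = a • (u - x) - b • (v - x) := by
    intro d hd
    induction hd using Submodule.span_induction with
    | mem d hd =>
      obtain ⟨u, hu, rfl⟩ := hd
      exact ⟨1, 0, zero_le_one, le_rfl, u, hu, x, hx, by simp⟩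
    | zero => exact ⟨0, 0, le_rfl, le_rfl, x, hx, x, hx, by simp⟩
    | add d d' _ _ hd hd' =>
      obtain ⟨a, b, ha, hb, u, hu, v, hv, rfl⟩ := hd
      obtain ⟨a', b', ha', hb', u', hu', v', hv', rfl⟩ := hd'
      obtain ⟨w, hw, e1, -⟩ := exists_cone_add hF x hu hu' ha ha'
      obtain ⟨z, hz, e3, -⟩ := exists_cone_add hG x hv hv' hb hb'
      refine ⟨a + a', b + b', by positivity, by positivity, w, hw, z, hz, ?_⟩
      rw [← e1, ← e3]; abel
    | smul c d _ hd =>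
      obtain ⟨a, b, ha, hb, u, hu, v, hv, rfl⟩ := hd
      rcases le_total 0 c with hc | hc
      · exact ⟨c * a, c * b, by positivity, by positivity, u, hu, v, hv, by module⟩
      · exact ⟨-c * b, -c * a, mul_nonneg (by linarith) hb, mul_nonneg (by linarith) ha,
          v, hv, u, hu, by module⟩
  have hUX : ∀ u ∈ X, u - x ∈ U := fun u hu => Submodule.subset_span ⟨u, hu, rfl⟩
  -- Riesz extension needs every vector to reach the cone by adding an element of the initial
  -- subspace. The cone only sees directions in `U`, so the subspace contains a complement of `U`.
  -- On it a cone element has direction `0`, which is the case of `cone_nonneg`.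
  obtain ⟨W, hW⟩ := Submodule.exists_isCompl U
  let f : (V × ℝ) →ₗ.[ℝ] ℝ :=
    ⟨Submodule.prod W ⊤, (LinearMap.snd ℝ V ℝ).comp (Submodule.prod W ⊤).subtype⟩
  obtain ⟨g, hg1, hg2⟩ := riesz_extension C f
    (by
      rintro ⟨⟨d, r⟩, hd⟩ ⟨a, b, ha, hb, u, hu, v, hv, h1, h2⟩
      change 0 ≤ r
      have hdW : d ∈ W := hd.1
      simp only at h1 h2
      have hdU : d ∈ U := by
        rw [h1]
        exact U.sub_mem (U.smul_mem _ (hUX u hu)) (U.smul_mem _ (hUX v hv))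
      have hd0 : d = 0 := by
        have : d ∈ U ⊓ W := ⟨hdU, hdW⟩
        rwa [hW.inf_eq_bot, Submodule.mem_bot] at this
      rw [hd0, eq_comm, sub_eq_zero] at h1
      refine le_trans ?_ h2
      rcases le_total b a with hba | hab
      · exact cone_nonneg hG hx hG0 hFG hu hv hb hba h1
      · rw [add_comm]
        exact cone_nonneg hF hx hF0 (fun u hu => by linarith [hFG u hu]) hv hu ha hab h1.symm)
    (by
      rintro ⟨d, r⟩
      have hd : d ∈ U ⊔ W := by rw [hW.sup_eq_top]; trivial
      obtain ⟨e, he, w, hw, rfl⟩ := Submodule.mem_sup.1 hd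
      obtain ⟨a, b, ha, hb, u, hu, v, hv, h1⟩ := hU e he
      refine ⟨⟨(-w, a * F u + b * G v - r), ⟨W.neg_mem hw, trivial⟩⟩, a, b, ha, hb, u, hu, v, hv,
        ?_, ?_⟩
      · change -w + (e + w) = _
        rw [← h1]; abel
      · change _ ≤ a * F u + b * G v - r + r
        linarith)
  have hg0 : g (0, 1) = 1 := hg1 ⟨(0, 1), ⟨W.zero_mem, trivial⟩⟩
  have hgr : ∀ d r, g (d, r) = g (d, 0) + r := by
    intro d r
    have : ((d, r) : V × ℝ) = (d, 0) + r • (0, 1) := by simp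
    rw [this, map_add, map_smul, hg0]; simp
  refine ⟨-(g.comp (LinearMap.inl ℝ V ℝ)), fun u hu => ?_, fun u hu => ?_⟩
  · have h := hg2 (u - x, F u) ⟨1, 0, zero_le_one, le_rfl, u, hu, x, hx, by simp, by simp⟩
    rw [hgr] at h
    simp only [LinearMap.neg_apply, LinearMap.comp_apply, LinearMap.inl_apply]
    linarith
  · have h := hg2 (-(u - x), G u) ⟨0, 1, le_rfl, zero_le_one, x, hx, u, hu, by simp, by simp⟩
    rw [hgr] at h
    have h2 : ((-(u - x), 0) : V × ℝ) = -(u - x, 0) := by simp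
    rw [h2, map_neg] at h
    simp only [LinearMap.neg_apply, LinearMap.comp_apply, LinearMap.inl_apply]
    linarith

end SumRule

/-! ### Optimality conditions, the linearized minimizer, and the dual prox-mapping. -/

section Prox

variable {E : Type*} [NormedAddCommGroup E] [NormedSpace ℝ E]

/-- The optimality condition for `g + h + γ ω` on `X`, in terms of subgradients of `h` and `ω`. -/
theorem exists_subgradients_of_isMinOn [FiniteDimensional ℝ E] {X : Set E} {h ω : E → ℝ} {γ : ℝ}
    (hγ : 0 < γ) (hh : ConvexOn ℝ X h) (hω : ConvexOn ℝ X ω) (g : E →L[ℝ] ℝ) {x : E} (hx : x ∈ X)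
    (hmin : IsMinOn (fun u => g u + h u + γ * ω u) X x) :
    ∃ d ∈ subdiffOn X h x, ∃ s ∈ subdiffOn X ω x, g + d + γ • s = 0 := by
  have hF : ConvexOn ℝ X (fun u => (h u + g u) + (-(h x + g x))) :=
    (hh.add (g.toLinearMap.convexOn hh.1)).add_const _
  have hG : ConvexOn ℝ X (fun u => γ • (ω u + (-ω x))) := (hω.add_const _).smul hγ.le
  obtain ⟨l, hl1, hl2⟩ := exists_linear_between hF hG hx (by simp) (by simp) (fun u hu => by
    have := hmin hu
    simp only [Set.mem_ofPred_eq] at this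
    simp only [smul_eq_mul]
    linarith)
  have hlc : ∀ u, l.toContinuousLinearMap u = l u := fun u => rfl
  refine ⟨l.toContinuousLinearMap - g, fun u hu => ?_, -(γ⁻¹ • l.toContinuousLinearMap),
    fun u hu => ?_, ?_⟩
  · have := hl1 u hu
    simp only [sub_apply, hlc, map_sub] at this ⊢
    linarith
  · have h1 := hl2 u hu
    simp only [smul_eq_mul] at h1
    simp only [neg_apply, smul_apply, hlc, smul_eq_mul]
    have h2 := mul_le_mul_of_nonneg_left h1 (inv_pos.2 hγ).le
    rw [← mul_assoc, inv_mul_cancel₀ hγ.ne'] at h2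
    linarith
  · rw [smul_neg, smul_smul, mul_inv_cancel₀ hγ.ne', one_smul]
    abel

/-- A convex function on a bounded closed set all of whose linear perturbations attain their
minimum attains its minimum also when perturbed by a smooth convex function; the minimizer is
characterized by the linearized problem. (The function need not be lower semicontinuous.) -/
theorem exists_linearized_min {X : Set E} (hXc : IsCompact X) (hXne : X.Nonempty)
    {f Φ : E → ℝ} {γ Lf : ℝ} (hγ : 0 < γ) (hf : ConvexOn ℝ Set.univ f) (hd : Differentiable ℝ f)
    (hL : ∀ x x', ‖fderiv ℝ f x - fderiv ℝ f x'‖ ≤ Lf * ‖x - x'‖)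
    (hΦ : StrongConvexOn X γ Φ)
    (hatt : ∀ g : E →L[ℝ] ℝ, ∃ x ∈ X, IsMinOn (fun u => g u + Φ u) X x) :
    ∃ x ∈ X, ∀ u ∈ X, Φ x + fderiv ℝ f x x ≤ Φ u + fderiv ℝ f x u := by
  have hconv : Convex ℝ X := hΦ.1
  set ψ : E → ℝ := fun u => f u + Φ u with hψ
  -- The tangent of `f` at any point of `X` minorizes `f`, and the linearized problem attains its
  -- minimum.
  have hbdd : BddBelow (ψ '' X) := by
    obtain ⟨x₁, hx₁⟩ := hXne
    obtain ⟨v, -, hv⟩ := hatt (fderiv ℝ f x₁)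
    refine ⟨f x₁ - fderiv ℝ f x₁ x₁ + (fderiv ℝ f x₁ v + Φ v), ?_⟩
    rintro _ ⟨u, hu, rfl⟩
    have h1 := hv hu
    have h2 := linGap_nonneg hf hd hL x₁ u
    simp only [Set.mem_ofPred_eq] at h1
    simp only [linGap, map_sub] at h2
    simp only [hψ]
    linarith
  set I := sInf (ψ '' X) with hI
  obtain ⟨w, -, hwlim, hw⟩ := exists_seq_tendsto_sInf (hXne.image ψ) hbdd
  choose u hu hψu using hw
  obtain ⟨x, hx, ϕ, hϕ, hux⟩ := hXc.tendsto_subseq hu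
  have hlim : Filter.Tendsto (fun n => ψ (u (ϕ n))) Filter.atTop (nhds I) := by
    have := hwlim.comp hϕ.tendsto_atTop
    refine this.congr fun n => ?_
    simp [hψu]
  -- The limit `x` of a minimizing sequence need not be a minimizer a priori. Instead `v` solves the
  -- problem linearized at `x`, and two bounds on the infimum `I` will force `x = v`.
  obtain ⟨v, hv, hvmin⟩ := hatt (fderiv ℝ f x)
  have hfc : Continuous f := hd.continuous
  have hup : I ≤ f x + fderiv ℝ f x (v - x) + Φ v := by
    apply le_of_forall_le_add_mul (c := Lf / 2 * ‖v - x‖ ^ 2)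
    intro t ht ht1
    -- Step from the minimizing sequence towards `v`. Along the sequence `Φ` enters only as `ψ - f`,
    -- whose limit is `I - f x`, so continuity of `f` is enough.
    have h1 : I ≤ f (x + t • (v - x)) + (1 - t) * (I - f x) + t * Φ v := by
      have hl : Filter.Tendsto (fun n => f (u (ϕ n) + t • (v - u (ϕ n))) +
          (1 - t) * (ψ (u (ϕ n)) - f (u (ϕ n))) + t * Φ v) Filter.atTop
          (nhds (f (x + t • (v - x)) + (1 - t) * (I - f x) + t * Φ v)) := by
        have hfu : Filter.Tendsto (fun n => f (u (ϕ n))) Filter.atTop (nhds (f x)) :=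
          (hfc.tendsto x).comp hux
        have hfw : Filter.Tendsto (fun n => f (u (ϕ n) + t • (v - u (ϕ n)))) Filter.atTop
            (nhds (f (x + t • (v - x)))) :=
          (hfc.tendsto _).comp (hux.add ((hux.const_sub v).const_smul t))
        exact (hfw.add ((hlim.sub hfu).const_mul (1 - t))).add_const _
      refine ge_of_tendsto' hl fun n => ?_
      have hmem := hconv (hu (ϕ n)) hv (by linarith : 0 ≤ 1 - t) ht.le (by ring)
      have h2 := (hΦ.convexOn (by intro r; positivity)).2 (hu (ϕ n)) hv (by linarith : 0 ≤ 1 - t)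
        ht.le (by ring)
      have h3 : (1 - t) • u (ϕ n) + t • v = u (ϕ n) + t • (v - u (ϕ n)) := by module
      rw [h3] at h2 hmem
      have h4 : I ≤ ψ (u (ϕ n) + t • (v - u (ϕ n))) := csInf_le hbdd ⟨_, hmem, rfl⟩
      simp only [hψ, smul_eq_mul] at h2 h4 ⊢
      linarith
    have h5 := le_quadratic_model hd hL x (x + t • (v - x))
    rw [add_sub_cancel_left, map_smul, norm_smul, Real.norm_of_nonneg ht.le, smul_eq_mul] at h5
    have h6 : t * I ≤ t * (f x + fderiv ℝ f x (v - x) + Φ v + t * (Lf / 2 * ‖v - x‖ ^ 2)) := by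
      nlinarith
    exact le_of_mul_le_mul_left h6 ht
  -- Quadratic growth of the linearized problem at its minimizer `v`, taken along the sequence.
  have hlow : f x + fderiv ℝ f x (v - x) + Φ v + γ / 2 * ‖x - v‖ ^ 2 ≤ I := by
    have hl : Filter.Tendsto (fun n => f x + fderiv ℝ f x (v - x) + Φ v +
        γ / 2 * ‖u (ϕ n) - v‖ ^ 2) Filter.atTop
        (nhds (f x + fderiv ℝ f x (v - x) + Φ v + γ / 2 * ‖x - v‖ ^ 2)) :=
      (((hux.sub_const v).norm.pow 2).const_mul _).const_add _
    refine le_of_tendsto_of_tendsto' hl hlim fun n => ?_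
    have hs : -fderiv ℝ f x ∈ subdiffOn X Φ v := by
      intro z hz
      have := hvmin hz
      simp only [Set.mem_ofPred_eq] at this
      simp only [neg_apply, map_sub]
      linarith
    have h1 := bregman_ge hΦ hv hs (hu (ϕ n))
    have h2 := linGap_nonneg hf hd hL x (u (ϕ n))
    simp only [linGap, map_sub, bregman, neg_apply] at h1 h2
    simp only [hψ, map_sub]
    linarith
  have hxv : x = v := by
    have h1 : γ / 2 * ‖x - v‖ ^ 2 ≤ 0 := by linarith
    have h2 : ‖x - v‖ ^ 2 ≤ 0 := by
      by_contra! h3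
      have : 0 < γ / 2 * ‖x - v‖ ^ 2 := by positivity
      linarith
    have h3 : ‖x - v‖ = 0 :=
      pow_eq_zero_iff two_ne_zero |>.1 (le_antisymm h2 (sq_nonneg ‖x - v‖))
    exact sub_eq_zero.1 (norm_eq_zero.1 h3)
  refine ⟨x, hx, fun z hz => ?_⟩
  have := hvmin hz
  rw [← hxv] at this
  simp only [Set.mem_ofPred_eq] at this
  linarith

theorem fderiv_mem_dualDomain {φ : E → ℝ} (hφ : ConvexOn ℝ Set.univ φ) (hd : Differentiable ℝ φ)
    {L : ℝ} (hL : ∀ x x', ‖fderiv ℝ φ x - fderiv ℝ φ x'‖ ≤ L * ‖x - x'‖) (z : E) :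
    fderiv ℝ φ z ∈ dualDomain φ := by
  refine ⟨fderiv ℝ φ z z - φ z, ?_⟩
  rintro _ ⟨x, rfl⟩
  have := linGap_nonneg hφ hd hL z x
  simp only [linGap, map_sub] at this
  simp only
  linarith

theorem conj_fderiv {φ : E → ℝ} (hφ : ConvexOn ℝ Set.univ φ) (hd : Differentiable ℝ φ)
    {L : ℝ} (hL : ∀ x x', ‖fderiv ℝ φ x - fderiv ℝ φ x'‖ ≤ L * ‖x - x'‖) (z : E) :
    conj φ (fderiv ℝ φ z) = fderiv ℝ φ z z - φ z := by
  apply le_antisymm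
  · apply ciSup_le
    intro x
    have := linGap_nonneg hφ hd hL z x
    simp only [linGap, map_sub] at this
    linarith
  · exact le_ciSup (f := fun x => fderiv ℝ φ z x - φ x) (fderiv_mem_dualDomain hφ hd hL z) z

/-- Fenchel's inequality. -/
theorem sub_le_conj {φ : E → ℝ} {y : E →L[ℝ] ℝ} (hy : y ∈ dualDomain φ) (x : E) :
    y x - φ x ≤ conj φ y :=
  le_ciSup (f := fun x => y x - φ x) hy x

theorem eq_fderiv_of_forall_le {φ : E → ℝ} {z : E} {y : E →L[ℝ] ℝ} (hd : DifferentiableAt ℝ φ z)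
    (h : ∀ x, φ z + y (x - z) ≤ φ x) : y = fderiv ℝ φ z := by
  have hmin : IsLocalMin (fun x => φ x - y x) z := by
    apply Filter.Eventually.of_forall
    intro x
    have := h x
    rw [map_sub] at this
    simp only
    linarith
  have h1 := hmin.fderiv_eq_zero
  have h2 : fderiv ℝ (fun x => φ x - y x) z = fderiv ℝ φ z - y := by
    rw [fderiv_fun_sub hd y.differentiableAt, y.fderiv]
  rw [h2, sub_eq_zero] at h1
  exact h1.symm

/-- The objective of the dual prox-mapping is, up to a constant, the conjugate perturbed by a single
linear function. -/
theorem dualProx_objective {φ : E → ℝ} {x' z z' : E} {τ : ℝ} (hτ : 0 < 1 + τ)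
    (hz' : z' = (1 + τ)⁻¹ • (x' + τ • z)) (y₀ v : E →L[ℝ] ℝ) :
    -v x' + conj φ v + τ * dualBregman φ z y₀ v =
      (1 + τ) * (conj φ v - v z') - τ * (conj φ y₀ - y₀ z) := by
  have h : (1 + τ) * v z' = v x' + τ * v z := by
    rw [hz', map_smul, map_add, map_smul, smul_eq_mul, smul_eq_mul, mul_inv_cancel_left₀ hτ.ne']
  simp only [dualBregman, sub_apply]
  linear_combination h

/-- Up to constants the objective is `(1 + τ) (J(v) - v z')`. Fenchel's inequality bounds `J(v) - v
z'` below by `-φ z'`, with equality exactly when `v` is a subgradient of `φ` at `z'`, that is, its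
derivative. -/
theorem isDualProx_iff {φ : E → ℝ} (hφ : ConvexOn ℝ Set.univ φ) (hd : Differentiable ℝ φ)
    {L : ℝ} (hL : ∀ x x', ‖fderiv ℝ φ x - fderiv ℝ φ x'‖ ≤ L * ‖x - x'‖) {x' z z' : E} {τ : ℝ}
    (hτ : 0 < 1 + τ) (hz' : z' = (1 + τ)⁻¹ • (x' + τ • z)) (y₀ y : E →L[ℝ] ℝ) :
    IsDualProx φ x' z y₀ τ y ↔ y = fderiv ℝ φ z' := by
  have hdom := fderiv_mem_dualDomain hφ hd hL z'
  constructor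
  · rintro ⟨hy, hmin⟩
    have h1 := hmin hdom
    simp only [Set.mem_ofPred_eq, dualProx_objective hτ hz', conj_fderiv hφ hd hL] at h1
    have h2 : (1 + τ) * (conj φ y - y z') ≤ (1 + τ) * (-φ z') := by linarith
    have h3 := le_of_mul_le_mul_left h2 hτ
    apply eq_fderiv_of_forall_le (hd z')
    intro x
    have := sub_le_conj hy x
    rw [map_sub]
    linarith
  · rintro rfl
    refine ⟨hdom, fun v hv => ?_⟩
    simp only [Set.mem_ofPred_eq, dualProx_objective hτ hz']
    rw [conj_fderiv hφ hd hL]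
    have := sub_le_conj hv z'
    have h2 : (1 + τ) * (-φ z') ≤ (1 + τ) * (conj φ v - v z') :=
      mul_le_mul_of_nonneg_left (by linarith) hτ.le
    linarith

end Prox

/-! ### One iteration: contraction of the Lyapunov function. -/

section Step

variable {E : Type*} [NormedAddCommGroup E] [NormedSpace ℝ E] {m : ℕ}

/-- The three-point inequality for the primal prox-mapping. -/
theorem IsPrimalProx.three_point {X : Set E} {h ω : E → ℝ} {μ η : ℝ} {g : E →L[ℝ] ℝ} {x₀ x₁ : E}
    {s₀ s₁ : E →L[ℝ] ℝ} (H : IsPrimalProx X h ω μ η g x₀ s₀ x₁ s₁) {u : E} (hu : u ∈ X) :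
    g (x₁ - u) + (h x₁ + μ * ω x₁) - (h u + μ * ω u) + (μ + η) * bregman ω s₁ x₁ u +
      η * bregman ω s₀ x₀ x₁ ≤ η * bregman ω s₀ x₀ u := by
  obtain ⟨d, hd, hopt⟩ := H.optimality
  have h1 := hopt u hu
  have h2 := hd u hu
  simp only [add_apply, sub_apply, smul_apply, map_sub, smul_eq_mul, bregman] at *
  linarith

theorem sum_eq_of_frozen {M : Type*} [AddCommGroup M] {F F' : Fin m → M} (j : Fin m)
    (h : ∀ i, i ≠ j → F' i = F i) : ∑ i, F' i = ∑ i, F i + (F' j - F j) := by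
  have : ∑ i, (F' i - F i) = F' j - F j :=
    Finset.sum_eq_single j (fun i _ hi => by rw [h i hi, sub_self]) (by simp)
  rw [← this, Finset.sum_sub_distrib]
  abel

/-- The requirements on the parameters of the method under which the Lyapunov function
decreases by the factor `α` in expectation. -/
structure Admissible (L : Fin m → ℝ) (p : Fin m → ℝ) (μ τ η α : ℝ) : Prop where
  prob_pos : ∀ i, 0 < p i
  prob_le_one : ∀ i, p i ≤ 1
  sum_prob : ∑ i, p i = 1
  lipschitz_le : ∀ i, L i ≤ 2 * (∑ j, L j) * p i
  tau_pos : 0 < τ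
  eta_nonneg : 0 ≤ η
  mul_le : 8 * ∑ j, L j ≤ η * τ
  alpha_nonneg : 0 ≤ α
  alpha_le_one : α ≤ 1
  eta_le : η ≤ α * (μ + η)
  tau_le : ∀ i, (1 - α) * (1 + τ) ≤ p i

/-- The properties of the states of the method which do not depend on the draws. -/
structure Consistent (X : Set E) (f : Fin m → E → ℝ) (ω : E → ℝ) (S : State E m) : Prop where
  mem : S.x ∈ X
  subgradient : S.s ∈ subdiffOn X ω S.x
  dual : ∀ i, S.y i = fderiv ℝ (f i) (S.z i)

/-- The Lyapunov function of the method with respect to the point `u`. -/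
noncomputable def lyapunov (f : Fin m → E → ℝ) (ω : E → ℝ) (p : Fin m → ℝ) (μ τ η : ℝ) (u : E)
    (S : State E m) : ℝ :=
  (μ + η) * bregman ω S.s S.x u + ∑ i, (1 + τ) / p i * linGap (f i) u (S.z i) +
    (∑ i, fderiv ℝ (f i) (S.z i) - ∑ i, fderiv ℝ (f i) u) (S.x - S.xPrev) +
    η / 4 * ‖S.x - S.xPrev‖ ^ 2

/-- The gap at `x` with respect to `u` of the problem in which `∑ i, f i` is linearized at `u`. -/
noncomputable def linearizedGap (f : Fin m → E → ℝ) (h ω : E → ℝ) (μ : ℝ) (u x : E) : ℝ :=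
  (h x + μ * ω x) - (h u + μ * ω u) + (∑ i, fderiv ℝ (f i) u) (x - u)

variable {X : Set E} {f : Fin m → E → ℝ} {h ω : E → ℝ} {L p : Fin m → ℝ} {μ τ η α : ℝ}

theorem IsStep.dual_eq (hf : ∀ i, ConvexOn ℝ Set.univ (f i)) (hd : ∀ i, Differentiable ℝ (f i))
    (hL : ∀ i x x', ‖fderiv ℝ (f i) x - fderiv ℝ (f i) x'‖ ≤ L i * ‖x - x'‖) (hτ : 0 < 1 + τ)
    {j : Fin m} {S S' : State E m} (H : IsStep X f h ω μ p τ η α j S S') :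
    S'.y j = fderiv ℝ (f j) (S'.z j) :=
  (isDualProx_iff (hf j) (hd j) (hL j) hτ H.selection _ _).1 H.dual_prox

theorem IsStep.consistent (hf : ∀ i, ConvexOn ℝ Set.univ (f i))
    (hd : ∀ i, Differentiable ℝ (f i))
    (hL : ∀ i x x', ‖fderiv ℝ (f i) x - fderiv ℝ (f i) x'‖ ≤ L i * ‖x - x'‖) (hτ : 0 < 1 + τ)
    {j : Fin m} {S S' : State E m} (hS : Consistent X f ω S)
    (H : IsStep X f h ω μ p τ η α j S S') : Consistent X f ω S' := by
  refine ⟨H.primal_prox.mem, H.primal_prox.subgradient, fun i => ?_⟩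
  by_cases hi : i = j
  · subst hi
    exact H.dual_eq hf hd hL hτ
  · rw [H.dual_frozen i hi, H.selection_frozen i hi, hS.dual i]

/-- A lower bound of the Lyapunov function. -/
theorem lyapunov_ge (hp : Admissible L p μ τ η α) (hf : ∀ i, ConvexOn ℝ Set.univ (f i))
    (hd : ∀ i, Differentiable ℝ (f i)) (hL0 : ∀ i, 0 ≤ L i)
    (hL : ∀ i x x', ‖fderiv ℝ (f i) x - fderiv ℝ (f i) x'‖ ≤ L i * ‖x - x'‖) (u : E)
    (S : State E m) :
    (μ + η) * bregman ω S.s S.x u ≤ lyapunov f ω p μ τ η u S := by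
  have hτ := hp.tau_pos
  set d := S.x - S.xPrev with hdd
  -- The weight `r = τ / p i` lets the dual distances absorb the cross term; the remainder `∑ L / (2
  -- τ)` is covered by `η / 4`.
  have key : ∀ i, -((fderiv ℝ (f i) (S.z i) - fderiv ℝ (f i) u) d) ≤
      (1 + τ) / p i * linGap (f i) u (S.z i) + L i / (2 * τ) * ‖d‖ ^ 2 := by
    intro i
    have hpi := hp.prob_pos i
    have h1 := fderiv_sub_apply_le (hf i) (hd i) (hL i) u (S.z i) (-d)
      (show 0 < τ / p i by positivity)
    rw [map_neg, norm_neg] at h1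
    have h0 := linGap_nonneg (hf i) (hd i) (hL i) u (S.z i)
    have h2 : τ / p i * linGap (f i) u (S.z i) ≤ (1 + τ) / p i * linGap (f i) u (S.z i) := by
      gcongr
      linarith
    have h3 : L i / (2 * (τ / p i)) ≤ L i / (2 * τ) := by
      apply div_le_div_of_nonneg_left (hL0 i) (by positivity)
      have : τ ≤ τ / p i := by
        rw [le_div_iff₀ hpi]
        nlinarith [hp.prob_le_one i]
      linarith
    have h4 := mul_le_mul_of_nonneg_right h3 (sq_nonneg ‖d‖)
    linarith
  have hsum := Finset.sum_le_sum fun i (_ : i ∈ Finset.univ) => key i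
  rw [Finset.sum_add_distrib, ← Finset.sum_mul, ← Finset.sum_div, Finset.sum_neg_distrib,
    ← sum_apply, Finset.sum_sub_distrib] at hsum
  have hη : (∑ i, L i) / (2 * τ) ≤ η / 4 := by
    rw [div_le_iff₀ (by positivity)]
    have := Finset.sum_nonneg fun i (_ : i ∈ Finset.univ) => hL0 i
    linarith [hp.mul_le]
  have h5 := mul_le_mul_of_nonneg_right hη (sq_nonneg ‖d‖)
  unfold lyapunov
  rw [← hdd]
  linarith

/-- The inequality which holds along every step, before the draw is averaged. -/
theorem IsStep.lyapunov_add_le (hp : Admissible L p μ τ η α)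
    (hf : ∀ i, ConvexOn ℝ Set.univ (f i))
    (hd : ∀ i, Differentiable ℝ (f i))
    (hL : ∀ i x x', ‖fderiv ℝ (f i) x - fderiv ℝ (f i) x'‖ ≤ L i * ‖x - x'‖)
    (hω : StrongConvexOn X 1 ω) {u : E} (hu : u ∈ X) {j : Fin m} {S S' : State E m}
    (hS : Consistent X f ω S) (H : IsStep X f h ω μ p τ η α j S S') :
    lyapunov f ω p μ τ η u S' + linearizedGap f h ω μ u S'.x ≤
      η * bregman ω S.s S.x u + ∑ i, (1 + τ) / p i * linGap (f i) u (S.z i) +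
      (1 + τ) / p j * (linGap (f j) u (S'.z j) - linGap (f j) u (S.z j)) +
      α * (∑ i, fderiv ℝ (f i) (S.z i) - ∑ i, fderiv ℝ (f i) u) (S.x - S.xPrev) +
      α * (η / 4 * ‖S.x - S.xPrev‖ ^ 2) -
      (∑ i, fderiv ℝ (f i) (S.z i) - ∑ i, fderiv ℝ (f i) u) (predict α S - u) -
      (p j)⁻¹ * (fderiv ℝ (f j) (S'.z j) - fderiv ℝ (f j) (S.z j)) (predict α S - u) +
      τ / p j * linGap (f j) (S'.z j) (S.z j) := by
  have hτ := hp.tau_pos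
  have hpj := hp.prob_pos j
  have hα := hp.alpha_nonneg
  have hη := hp.eta_nonneg
  have hyj := H.dual_eq hf hd hL (by linarith)
  have hW : ∑ i, (1 + τ) / p i * linGap (f i) u (S'.z i) =
      ∑ i, (1 + τ) / p i * linGap (f i) u (S.z i) +
      ((1 + τ) / p j * linGap (f j) u (S'.z j) - (1 + τ) / p j * linGap (f j) u (S.z j)) :=
    sum_eq_of_frozen j fun i hi => by rw [H.selection_frozen i hi]
  have hY' : ∑ i, fderiv ℝ (f i) (S'.z i) = ∑ i, fderiv ℝ (f i) (S.z i) +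
      (fderiv ℝ (f j) (S'.z j) - fderiv ℝ (f j) (S.z j)) :=
    sum_eq_of_frozen j fun i hi => by rw [H.selection_frozen i hi]
  have hg : (∑ i, if i = j then (p i)⁻¹ • (S'.y i - S.y i) + S.y i else S.y i) =
      ∑ i, fderiv ℝ (f i) (S.z i) +
      (p j)⁻¹ • (fderiv ℝ (f j) (S'.z j) - fderiv ℝ (f j) (S.z j)) := by
    rw [sum_eq_of_frozen (F := fun i => fderiv ℝ (f i) (S.z i)) j fun i hi => by
      simp [hi, hS.dual i]]
    simp [hyj, hS.dual j]
  have h1 := H.primal_prox.three_point hu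
  rw [hg] at h1
  have hbreg := bregman_ge hω hS.mem hS.subgradient H.primal_prox.mem
  set Y := ∑ i, fderiv ℝ (f i) (S.z i) with hYdef
  set Ys := ∑ i, fderiv ℝ (f i) u with hYs
  set Δ := fderiv ℝ (f j) (S'.z j) - fderiv ℝ (f j) (S.z j) with hΔ
  set D := linGap (f j) (S'.z j) (S.z j) with hD
  have hD0 : 0 ≤ D := linGap_nonneg (hf j) (hd j) (hL j) _ _
  set d := S.x - S.xPrev with hdd
  set e := S'.x - S.x with hee
  -- This uses the factor `8` of `mul_le` in full: `L j / p j ≤ 2 ∑ L` and `8 ∑ L ≤ η τ`.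
  have hcoef : (p j)⁻¹ * (L j / (2 * (τ / 2))) ≤ η / 4 := by
    rw [inv_mul_eq_div, div_div, div_le_iff₀ (by positivity)]
    nlinarith [hp.lipschitz_le j, mul_le_mul_of_nonneg_right hp.mul_le hpj.le]
  have hneg : fderiv ℝ (f j) (S.z j) - fderiv ℝ (f j) (S'.z j) = -Δ := by rw [hΔ]; abel
  -- Two products with the dual increment remain: with the new displacement `e` and with the
  -- extrapolation `α d`. Each takes half of `τ D / p j`. Of the `η / 2 ‖e‖²` contained in the
  -- primal distance, half pays for the first and half enters the new Lyapunov function.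
  have c1 := fderiv_sub_apply_le (hf j) (hd j) (hL j) (S'.z j) (S.z j) e
    (show 0 < τ / 2 by positivity)
  have c2 := fderiv_sub_apply_le (hf j) (hd j) (hL j) (S'.z j) (S.z j) (-(α • d))
    (show 0 < τ / 2 by positivity)
  rw [hneg, ← hD, neg_apply] at c1 c2
  rw [map_neg, neg_neg, map_smul, norm_neg, norm_smul, Real.norm_of_nonneg hα, smul_eq_mul] at c2
  have hpinv : 1 ≤ (p j)⁻¹ := (one_le_inv₀ hpj).2 (hp.prob_le_one j)
  have c1' : ((p j)⁻¹ - 1) * (-Δ e) ≤ (p j)⁻¹ * (τ / 2 * D) + η / 4 * ‖e‖ ^ 2 := by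
    have hLj : 0 ≤ τ / 2 * D + L j / (2 * (τ / 2)) * ‖e‖ ^ 2 := by
      -- For `e ≠ 0` the Lipschitz bound itself forces `L j ≥ 0`.
      have hL0 : 0 ≤ L j / (2 * (τ / 2)) * ‖e‖ ^ 2 := by
        rcases eq_or_ne e 0 with he | he
        · simp [he]
        · have hh := (norm_nonneg _).trans (hL j e 0)
          rw [sub_zero] at hh
          have : 0 < ‖e‖ := norm_pos_iff.2 he
          have : 0 ≤ L j := nonneg_of_mul_nonneg_left hh this
          positivity
      positivity
    calc _ ≤ ((p j)⁻¹ - 1) * (τ / 2 * D + L j / (2 * (τ / 2)) * ‖e‖ ^ 2) :=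
          mul_le_mul_of_nonneg_left c1 (by linarith)
      _ ≤ (p j)⁻¹ * (τ / 2 * D + L j / (2 * (τ / 2)) * ‖e‖ ^ 2) :=
          mul_le_mul_of_nonneg_right (by linarith) hLj
      _ ≤ _ := by
          have := mul_le_mul_of_nonneg_right hcoef (sq_nonneg ‖e‖)
          linarith
  have c2' : (p j)⁻¹ * (α * Δ d) ≤ (p j)⁻¹ * (τ / 2 * D) + α * (η / 4 * ‖d‖ ^ 2) := by
    have q1 := mul_le_mul_of_nonneg_left c2 (inv_pos.2 hpj).le
    have q2 := mul_le_mul_of_nonneg_right hcoef (sq_nonneg (α * ‖d‖))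
    have q3 : η / 4 * (α * ‖d‖) ^ 2 ≤ α * (η / 4 * ‖d‖ ^ 2) := by
      have : α ^ 2 ≤ α := by nlinarith [hp.alpha_le_one]
      calc η / 4 * (α * ‖d‖) ^ 2 = α ^ 2 * (η / 4 * ‖d‖ ^ 2) := by ring
        _ ≤ _ := mul_le_mul_of_nonneg_right this (by positivity)
    linarith
  have hx1 : S'.x - u = (predict α S - u) + e - α • d := by
    simp only [predict, hee, hdd]; module
  have hη1 := mul_le_mul_of_nonneg_left hbreg hη
  have hdiv : τ / p j * D = (p j)⁻¹ * (τ * D) := by rw [div_eq_inv_mul, mul_assoc]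
  unfold lyapunov linearizedGap
  rw [H.xPrev_eq, hW, hY', ← hYs, ← hee, hx1, hdiv]
  rw [hx1] at h1
  simp only [add_apply, sub_apply, smul_apply, map_add, map_sub, map_smul, smul_eq_mul] at *
  linarith

/-- The three-point relation of the dual step, an exact identity: substitute `x' - u = (1 + τ) (z' -
u) - τ (z - u)`. -/
theorem dual_block_identity {φ : E → ℝ} {x' z z' u : E} (hτ : 0 < 1 + τ)
    (hz' : z' = (1 + τ)⁻¹ • (x' + τ • z)) :
    (fderiv ℝ φ z' - fderiv ℝ φ u) (x' - u) = linGap φ z' u + (1 + τ) * linGap φ u z' +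
      τ * linGap φ z' z - τ * linGap φ u z := by
  have hx' : x' = (1 + τ) • z' - τ • z := by
    rw [hz', smul_inv_smul₀ hτ.ne']; abel
  rw [hx']
  simp only [linGap, sub_apply, map_sub, map_smul, smul_eq_mul]
  ring

/-- The Lyapunov function decreases in expectation. -/
theorem sum_prob_mul_lyapunov_le (hp : Admissible L p μ τ η α)
    (hf : ∀ i, ConvexOn ℝ Set.univ (f i))
    (hd : ∀ i, Differentiable ℝ (f i))
    (hL : ∀ i x x', ‖fderiv ℝ (f i) x - fderiv ℝ (f i) x'‖ ≤ L i * ‖x - x'‖)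
    (hω : StrongConvexOn X 1 ω) {u : E} (hu : u ∈ X) {S : State E m} {S' : Fin m → State E m}
    (hS : Consistent X f ω S) (H : ∀ j, IsStep X f h ω μ p τ η α j S (S' j)) :
    ∑ j, p j * (lyapunov f ω p μ τ η u (S' j) + linearizedGap f h ω μ u (S' j).x) ≤
      α * lyapunov f ω p μ τ η u S := by
  have hτ := hp.tau_pos
  set C := η * bregman ω S.s S.x u + ∑ i, (1 + τ) / p i * linGap (f i) u (S.z i) +
      α * (∑ i, fderiv ℝ (f i) (S.z i) - ∑ i, fderiv ℝ (f i) u) (S.x - S.xPrev) +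
      α * (η / 4 * ‖S.x - S.xPrev‖ ^ 2) -
      (∑ i, fderiv ℝ (f i) (S.z i) - ∑ i, fderiv ℝ (f i) u) (predict α S - u) with hC
  -- Multiplication by `p j` cancels the weights `1 / p j`, and the dual identity trades all
  -- products with the new gradient for gaps. The products left over involve only the old gradients;
  -- summed over `j` they cancel the last term of `C`. This is why the dual prediction is scaled by
  -- `p j⁻¹`.
  have h1 : ∀ j ∈ Finset.univ,
      p j * (lyapunov f ω p μ τ η u (S' j) + linearizedGap f h ω μ u (S' j).x) ≤
      p j * C + ((fderiv ℝ (f j) (S.z j) - fderiv ℝ (f j) u) (predict α S - u) -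
        linGap (f j) u (S.z j) - linGap (f j) ((S' j).z j) u) := by
    intro j _
    have hpj := hp.prob_pos j
    have h2 := mul_le_mul_of_nonneg_left
      ((H j).lyapunov_add_le hp hf hd hL hω hu hS) hpj.le
    refine h2.trans (le_of_eq ?_)
    have hid := dual_block_identity (φ := f j) (u := u) (by linarith : 0 < 1 + τ) (H j).selection
    have e1 : p j * (p j)⁻¹ = 1 := mul_inv_cancel₀ hpj.ne'
    simp only [div_eq_mul_inv, hC] at *
    simp only [sub_apply] at *
    linear_combination -hid +
      ((1 + τ) * (linGap (f j) u ((S' j).z j) - linGap (f j) u (S.z j)) -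
      (fderiv ℝ (f j) ((S' j).z j) (predict α S - u) -
        fderiv ℝ (f j) (S.z j) (predict α S - u)) +
      τ * linGap (f j) ((S' j).z j) (S.z j)) * e1
  refine (Finset.sum_le_sum h1).trans ?_
  rw [Finset.sum_add_distrib, ← Finset.sum_mul, hp.sum_prob, one_mul, Finset.sum_sub_distrib,
    Finset.sum_sub_distrib, ← sum_apply, Finset.sum_sub_distrib]
  have h3 : 0 ≤ ∑ j, linGap (f j) ((S' j).z j) u :=
    Finset.sum_nonneg fun j _ => linGap_nonneg (hf j) (hd j) (hL j) _ _
  -- Contraction of the dual distances, from `(1 - α) (1 + τ) ≤ p i`.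
  have h4 : ∑ i, (1 + τ) / p i * linGap (f i) u (S.z i) - ∑ i, linGap (f i) u (S.z i) ≤
      α * ∑ i, (1 + τ) / p i * linGap (f i) u (S.z i) := by
    rw [Finset.mul_sum, ← Finset.sum_sub_distrib]
    apply Finset.sum_le_sum
    intro i _
    have hpi := hp.prob_pos i
    have hg := linGap_nonneg (hf i) (hd i) (hL i) u (S.z i)
    have h5 : (1 - α) * ((1 + τ) / p i) ≤ 1 := by
      rw [← mul_div_assoc]
      exact (div_le_one hpi).2 (hp.tau_le i)
    nlinarith [mul_le_mul_of_nonneg_right h5 hg]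
  have h6 := mul_le_mul_of_nonneg_right hp.eta_le (bregman_nonneg hS.subgradient hu)
  unfold lyapunov
  simp only [hC]
  linarith

end Step

/-! ### Existence of executions and draw-independent invariants. -/

section Existence

variable {E : Type*} [NormedAddCommGroup E] [NormedSpace ℝ E] {m : ℕ}
  {X : Set E} {f : Fin m → E → ℝ} {h ω : E → ℝ} {L p : Fin m → ℝ} {μ τ η α : ℝ}

theorem exists_isStep [FiniteDimensional ℝ E] (hf : ∀ i, ConvexOn ℝ Set.univ (f i))
    (hd : ∀ i, Differentiable ℝ (f i))
    (hL : ∀ i x x', ‖fderiv ℝ (f i) x - fderiv ℝ (f i) x'‖ ≤ L i * ‖x - x'‖)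
    (hh : ConvexOn ℝ X h) (hω : ConvexOn ℝ X ω)
    (hatt : ∀ (g : E →L[ℝ] ℝ) (γ : ℝ), 0 < γ →
      ∃ x ∈ X, IsMinOn (fun u => g u + h u + γ * ω u) X x)
    (hτ : 0 < 1 + τ) (hη : 0 < μ + η) (j : Fin m) (S : State E m) :
    ∃ S', IsStep X f h ω μ p τ η α j S S' := by
  set z' := (1 + τ)⁻¹ • (predict α S + τ • S.z j) with hz'
  set y' := fderiv ℝ (f j) z' with hy'
  set g : E →L[ℝ] ℝ := ∑ i, if i = j then (p i)⁻¹ • (y' - S.y i) + S.y i else S.y i with hg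
  -- Up to a constant, `η P(S.x, ·)` is `η ω - η S.s`, so the primal prox-problem is of the assumed
  -- solvable form. The sum rule makes the optimality vector vanish outright.
  obtain ⟨x₁, hx₁, hmin⟩ := hatt (g - η • S.s) (μ + η) hη
  obtain ⟨d, hd', s, hs, hsum⟩ := exists_subgradients_of_isMinOn hη hh hω _ hx₁ hmin
  have hz : ∀ i, i ≠ j → Function.update S.z j z' i = S.z i := fun i hi => by simp [hi]
  have hy : ∀ i, i ≠ j → Function.update S.y j y' i = S.y i := fun i hi => by simp [hi]
  have hg' : (∑ i, if i = j then (p i)⁻¹ • (Function.update S.y j y' i - S.y i) + S.y i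
      else S.y i) = g := by
    rw [hg]
    refine Finset.sum_congr rfl fun i _ => ?_
    by_cases hi : i = j
    · subst hi; simp
    · simp [hi]
  refine ⟨⟨x₁, S.x, s, Function.update S.y j y', Function.update S.z j z'⟩, rfl, ?_, hy, ?_, hz, ?_⟩
  · simp only [Function.update_self]
    exact (isDualProx_iff (hf j) (hd j) (hL j) hτ hz' _ _).2 rfl
  · simp [hz']
  · simp only [hg']
    refine ⟨hx₁, ?_, hs, d, hd', fun u _ => ?_⟩
    · intro u hu
      have h1 := hmin hu
      simp only [Set.mem_ofPred_eq, sub_apply, smul_apply, smul_eq_mul, bregman, map_sub] at h1 ⊢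
      linarith
    · have h2 : g + d + (μ + η) • s - η • S.s = g - η • S.s + d + (μ + η) • s := by abel
      rw [h2, hsum]
      simp

theorem nonempty_execution {τ η α : ℕ → ℝ} {x₀ : E} {s₀ : E →L[ℝ] ℝ}
    (H : ∀ t j (S : State E m), ∃ S', IsStep X f h ω μ p (τ t) (η t) (α t) j S S') :
    Nonempty (Execution X f h ω μ p τ η α x₀ s₀) := by
  choose next hnext using H
  refine ⟨⟨fun t ξ => Nat.rec (initialState f x₀ s₀) (fun r S => next (r + 1) (ξ r) S) t,
    fun ξ => rfl, fun t ξ => hnext _ _ _, fun t ξ ξ' hξ => ?_⟩⟩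
  induction t with
  | zero => rfl
  | succ t ih =>
    change next (t + 1) (ξ t) _ = next (t + 1) (ξ' t) _
    rw [hξ t (Nat.lt_succ_self t)]
    congr 1
    exact ih fun r hr => hξ r (hr.trans (Nat.lt_succ_self t))

theorem Execution.consistent (hf : ∀ i, ConvexOn ℝ Set.univ (f i))
    (hd : ∀ i, Differentiable ℝ (f i))
    (hL : ∀ i x x', ‖fderiv ℝ (f i) x - fderiv ℝ (f i) x'‖ ≤ L i * ‖x - x'‖)
    {τ η α : ℕ → ℝ} (hτ : ∀ t, 0 < 1 + τ t) {x₀ : E} {s₀ : E →L[ℝ] ℝ} (hx₀ : x₀ ∈ X)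
    (hs₀ : s₀ ∈ subdiffOn X ω x₀) (A : Execution X f h ω μ p τ η α x₀ s₀) (t : ℕ)
    (ξ : ℕ → Fin m) : Consistent X f ω (A.state t ξ) := by
  induction t with
  | zero =>
    rw [A.initial]
    exact ⟨hx₀, hs₀, fun i => rfl⟩
  | succ t ih => exact (A.step t ξ).consistent hf hd hL (hτ _) ih

end Existence

/-! ### The perturbed simple term differs from `h` by an affine function. -/

section Perturbation

variable {E : Type*} [NormedAddCommGroup E] [NormedSpace ℝ E] {X : Set E} {h ω : E → ℝ}

theorem perturbed_eq (δ : ℝ) (x₀ : E) (s₀ : E →L[ℝ] ℝ) :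
    perturbed h ω δ x₀ s₀ = fun x => (h x + (-(δ • s₀)) x) + (-(δ * (ω x₀ - s₀ x₀))) := by
  funext x
  simp only [perturbed, map_sub, neg_apply, smul_apply, smul_eq_mul]
  ring

theorem convexOn_perturbed (hh : ConvexOn ℝ X h) (δ : ℝ) (x₀ : E) (s₀ : E →L[ℝ] ℝ) :
    ConvexOn ℝ X (perturbed h ω δ x₀ s₀) := by
  rw [perturbed_eq]
  exact (hh.add ((-(δ • s₀)).toLinearMap.convexOn hh.1)).add_const _

theorem exists_isMinOn_perturbed
    (hatt : ∀ (g : E →L[ℝ] ℝ) (γ : ℝ), 0 < γ →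
      ∃ x ∈ X, IsMinOn (fun u => g u + h u + γ * ω u) X x)
    (δ : ℝ) (x₀ : E) (s₀ : E →L[ℝ] ℝ) (g : E →L[ℝ] ℝ) (γ : ℝ) (hγ : 0 < γ) :
    ∃ x ∈ X, IsMinOn (fun u => g u + perturbed h ω δ x₀ s₀ u + γ * ω u) X x := by
  obtain ⟨x, hx, hmin⟩ := hatt (g - δ • s₀) γ hγ
  refine ⟨x, hx, fun u hu => ?_⟩
  have := hmin hu
  simp only [Set.mem_ofPred_eq, perturbed_eq, sub_apply, neg_apply, smul_apply,
    smul_eq_mul] at this ⊢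
  linarith

end Perturbation

/-! ### The balance of the constant parameters. -/

section Parameters

variable {m : ℕ} {L : Fin m → ℝ} {μ : ℝ}

theorem one_le_of_sum_pos (hL : 0 < ∑ i, L i) : (1 : ℝ) ≤ m := by
  rcases Nat.eq_zero_or_pos m with rfl | hm
  · simp at hL
  · exact_mod_cast hm

theorem root_sq (hμ : 0 < μ) (hL : 0 < ∑ i, L i) :
    root μ L ^ 2 = ((m : ℝ) - 1) ^ 2 + 4 * m * (8 * (∑ j, L j) / μ) :=
  Real.sq_sqrt (by positivity)

theorem lt_root (hμ : 0 < μ) (hL : 0 < ∑ i, L i) : (m : ℝ) - 1 < root μ L := by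
  have hm := one_le_of_sum_pos hL
  apply lt_of_pow_lt_pow_left₀ 2 (Real.sqrt_nonneg _)
  have := root_sq hμ hL
  have h2 : 0 < 4 * (m : ℝ) * (8 * (∑ j, L j) / μ) := by positivity
  change _ < root μ L ^ 2
  rw [this]
  linarith

theorem one_sub_alpha (L : Fin m → ℝ) (μ : ℝ) : 1 - alpha μ L = (m + 1 + root μ L)⁻¹ := by
  simp [alpha]

theorem one_sub_alpha_pos (L : Fin m → ℝ) (μ : ℝ) : 0 < 1 - alpha μ L := by
  rw [one_sub_alpha]
  have : 0 ≤ root μ L := Real.sqrt_nonneg _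
  positivity

theorem alpha_pos (hL : 0 < ∑ i, L i) (μ : ℝ) : 0 < alpha μ L := by
  have hm := one_le_of_sum_pos hL
  have : 0 ≤ root μ L := Real.sqrt_nonneg _
  have h1 : (m + 1 + root μ L)⁻¹ < 1 := inv_lt_one_of_one_lt₀ (by linarith)
  have := one_sub_alpha L μ
  linarith

theorem one_sub_alpha_mul_one_add_tau (hL : 0 < ∑ i, L i) (μ : ℝ) :
    (1 - alpha μ L) * (1 + tau μ L) = 1 / (2 * m) := by
  have hm := one_le_of_sum_pos hL
  have : 0 ≤ root μ L := Real.sqrt_nonneg _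
  have h1 : (m : ℝ) + 1 + root μ L ≠ 0 := by positivity
  have hm0 : (m : ℝ) ≠ 0 := by positivity
  rw [one_sub_alpha, tau]
  field_simp
  ring

theorem one_sub_alpha_mul_mu_add_eta (μ : ℝ) (L : Fin m → ℝ) :
    (1 - alpha μ L) * (μ + eta μ L) = μ / 2 := by
  have : 0 ≤ root μ L := Real.sqrt_nonneg _
  have h1 : (m : ℝ) + 1 + root μ L ≠ 0 := by positivity
  rw [one_sub_alpha, eta]
  field_simp
  ring

theorem eta_mul_tau (hμ : 0 < μ) (hL : 0 < ∑ i, L i) :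
    eta μ L * tau μ L = 8 * ∑ j, L j := by
  have hm := one_le_of_sum_pos hL
  have hm0 : (m : ℝ) ≠ 0 := by positivity
  have h1 : eta μ L * tau μ L = μ * (root μ L ^ 2 - ((m : ℝ) - 1) ^ 2) / (4 * m) := by
    rw [eta, tau]
    field_simp
    ring
  rw [h1, root_sq hμ hL]
  field_simp
  ring

theorem sum_prob_eq_one (hL : 0 < ∑ i, L i) : ∑ i, prob L i = 1 := by
  have hm := one_le_of_sum_pos hL
  have hm0 : (m : ℝ) ≠ 0 := by positivity
  simp only [prob]
  rw [Finset.sum_add_distrib, Finset.sum_const, Finset.card_univ, Fintype.card_fin,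
    nsmul_eq_mul, ← Finset.sum_div]
  field_simp
  norm_num

theorem prob_ge (hL0 : ∀ i, 0 ≤ L i) (hL : 0 < ∑ i, L i) (i : Fin m) :
    1 / (2 * (m : ℝ)) ≤ prob L i := by
  have : 0 ≤ L i / (2 * ∑ j, L j) := div_nonneg (hL0 i) (by linarith)
  unfold prob
  linarith

/-- The uniform half of the probabilities gives `p i ≥ 1 / (2 m) = (1 - α) (1 + τ)`; the half
proportional to `L i` gives `L i ≤ 2 (∑ L) p i`. -/
theorem admissible (hμ : 0 < μ) (hL0 : ∀ i, 0 ≤ L i) (hL : 0 < ∑ i, L i) :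
    Admissible L (prob L) μ (tau μ L) (eta μ L) (alpha μ L) := by
  have hm := one_le_of_sum_pos hL
  have hpos : ∀ i, 0 < prob L i := fun i =>
    lt_of_lt_of_le (by positivity) (prob_ge hL0 hL i)
  have hroot := lt_root hμ hL
  have hα := one_sub_alpha_pos L μ
  refine
    { prob_pos := hpos
      prob_le_one := fun i => ?_
      sum_prob := sum_prob_eq_one hL
      lipschitz_le := fun i => ?_
      tau_pos := div_pos (by linarith) (by linarith)
      eta_nonneg := ?_
      mul_le := (eta_mul_tau hμ hL).ge
      alpha_nonneg := (alpha_pos hL μ).le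
      alpha_le_one := by linarith
      eta_le := ?_
      tau_le := fun i => ?_ }
  · rw [← sum_prob_eq_one hL]
    exact Finset.single_le_sum (fun j _ => (hpos j).le) (Finset.mem_univ i)
  · have h1 : L i / (2 * ∑ j, L j) ≤ prob L i := by
      have : 0 ≤ 1 / (2 * (m : ℝ)) := by positivity
      unfold prob
      linarith
    rw [div_le_iff₀ (by linarith)] at h1
    linarith
  · have : 0 ≤ (m : ℝ) - 1 := by linarith
    have : 0 ≤ root μ L := Real.sqrt_nonneg _
    unfold eta
    positivity
  · have := one_sub_alpha_mul_mu_add_eta μ L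
    linarith
  · rw [one_sub_alpha_mul_one_add_tau hL]
    exact prob_ge hL0 hL i

/-- The Lyapunov function at the starting point. -/
theorem lyapunov_initial_le {E : Type*} [NormedAddCommGroup E] [NormedSpace ℝ E]
    {X : Set E} {f : Fin m → E → ℝ} {ω : E → ℝ} {Lf R : ℝ} (hμ : 0 < μ)
    (hf : ∀ i, ConvexOn ℝ Set.univ (f i)) (hd : ∀ i, Differentiable ℝ (f i))
    (hL0 : ∀ i, 0 ≤ L i) (hL : 0 < ∑ i, L i)
    (hLi : ∀ i x x', ‖fderiv ℝ (f i) x - fderiv ℝ (f i) x'‖ ≤ L i * ‖x - x'‖) (hLf0 : 0 ≤ Lf)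
    (hLf : ∀ x x', ‖∑ i, fderiv ℝ (f i) x - ∑ i, fderiv ℝ (f i) x'‖ ≤ Lf * ‖x - x'‖)
    (hω : StrongConvexOn X 1 ω) {x₀ u : E} {s₀ : E →L[ℝ] ℝ} (hx₀ : x₀ ∈ X) (hu : u ∈ X)
    (hs₀ : s₀ ∈ subdiffOn X ω x₀) (hR : bregman ω s₀ x₀ u ≤ R ^ 2) :
    (1 - alpha μ L) * lyapunov f ω (prob L) μ (tau μ L) (eta μ L) u (initialState f x₀ s₀) ≤
      (μ / 2 + Lf) * R ^ 2 := by
  have hm := one_le_of_sum_pos hL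
  have hp := admissible hμ hL0 hL
  have hα := one_sub_alpha_pos L μ
  have hfd : ∀ x, fderiv ℝ (fun y => ∑ i, f i y) x = ∑ i, fderiv ℝ (f i) x := fun x =>
    fderiv_fun_sum fun i _ => hd i x
  -- Initially all `z i` equal `x₀`, so the gaps add up to the gap of the sum, and `Lf` can be used
  -- in place of `∑ L`.
  have h1 : ∑ i, linGap (f i) u x₀ ≤ Lf * R ^ 2 := by
    have e : ∑ i, linGap (f i) u x₀ = linGap (fun y => ∑ i, f i y) u x₀ := by
      simp only [linGap, hfd, Finset.sum_sub_distrib, sum_apply]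
    rw [e]
    have h2 := linGap_le (f := fun y => ∑ i, f i y) (Differentiable.fun_sum fun i _ => hd i)
      (fun x x' => by rw [hfd, hfd]; exact hLf x x') u x₀
    have h3 := bregman_ge hω hx₀ hs₀ hu
    rw [norm_sub_rev] at h3
    nlinarith
  have h2 : (1 - alpha μ L) * ∑ i, (1 + tau μ L) / prob L i * linGap (f i) u x₀ ≤
      ∑ i, linGap (f i) u x₀ := by
    rw [Finset.mul_sum]
    apply Finset.sum_le_sum
    intro i _
    have h5 : (1 - alpha μ L) * ((1 + tau μ L) / prob L i) ≤ 1 := by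
      rw [← mul_div_assoc]
      exact (div_le_one (hp.prob_pos i)).2 (hp.tau_le i)
    have := mul_le_mul_of_nonneg_right h5 (linGap_nonneg (hf i) (hd i) (hLi i) u x₀)
    linarith
  have h4 : (1 - alpha μ L) * ((μ + eta μ L) * bregman ω s₀ x₀ u) ≤ μ / 2 * R ^ 2 := by
    rw [← mul_assoc, one_sub_alpha_mul_mu_add_eta]
    gcongr
  simp only [lyapunov, initialState, sub_self, map_zero, norm_zero]
  nlinarith

end Parameters

/-! ### Integration of functions of finitely many independent draws. -/

section Draws

variable {m : ℕ} {S : Type*} [MeasurableSpace S] {P : Measure S} {i : ℕ → S → Fin m}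

/-- Factoring through a finite type makes measurability and integrability automatic, however the
subgradients are selected. The value `j₀` fills the later draws, which do not matter. -/
theorem DependsOn.exists_tuple {G : (ℕ → Fin m) → ℝ} {t : ℕ} (hG : DependsOn G (Set.Iio t))
    (j₀ : Fin m) :
    ∃ H : (Finset.range t → Fin m) → ℝ, ∀ ξ, G ξ = H (fun r => ξ r) := by
  refine ⟨fun v => G fun r => if hr : r ∈ Finset.range t then v ⟨r, hr⟩ else j₀, fun ξ => ?_⟩
  apply hG
  intro r hr
  have : r ∈ Finset.range t := Finset.mem_range.2 hr
  simp only [this, dite_true]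

theorem integrable_of_dependsOn [IsProbabilityMeasure P] (hi : ∀ t, Measurable (i t))
    {G : (ℕ → Fin m) → ℝ} {t : ℕ} (hG : DependsOn G (Set.Iio t)) :
    Integrable (fun w => G fun t => i t w) P := by
  obtain ⟨w₀⟩ : Nonempty S := P.nonempty_of_neZero
  obtain ⟨H, hH⟩ := DependsOn.exists_tuple hG (i 0 w₀)
  simp only [hH]
  have hm : Measurable fun w (r : Finset.range t) => i r w := measurable_pi_lambda _ fun r => hi r
  have : IsProbabilityMeasure (P.map fun w (r : Finset.range t) => i r w) :=
    Measure.isProbabilityMeasure_map hm.aemeasurable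
  exact (Integrable.of_finite (f := H)
    (μ := P.map fun w (r : Finset.range t) => i r w)).comp_measurable hm

/-- Conditioning on the last of the draws on which a function depends. -/
theorem integral_eq_sum_prob [IsProbabilityMeasure P] (hi : ∀ t, Measurable (i t))
    (hind : iIndepFun i P) {p : Fin m → ℝ} (hp0 : ∀ j, 0 ≤ p j)
    (hp : ∀ t j, P (i t ⁻¹' {j}) = ENNReal.ofReal (p j)) {G : (ℕ → Fin m) → ℝ} {t : ℕ}
    (hG : DependsOn G (Set.Iio (t + 1))) :
    ∫ w, G (fun t => i t w) ∂P =
      ∑ j, p j * ∫ w, G (Function.update (fun t => i t w) t j) ∂P := by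
  obtain ⟨w₀⟩ : Nonempty S := P.nonempty_of_neZero
  have hGj : ∀ j, DependsOn (fun ξ => G (Function.update ξ t j)) (Set.Iio t) := by
    intro j ξ ξ' h
    apply hG
    intro r hr
    rcases eq_or_ne r t with rfl | hrt
    · simp
    · rw [Function.update_of_ne hrt, Function.update_of_ne hrt]
      exact h r (lt_of_le_of_ne (Nat.lt_succ_iff.1 hr) hrt)
  have hsplit : ∀ w, G (fun t => i t w) =
      ∑ j, (i t ⁻¹' {j}).indicator 1 w * G (Function.update (fun t => i t w) t j) := by
    intro w
    rw [Finset.sum_eq_single (i t w)]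
    · simp
    · intro j _ hj
      rw [Set.indicator_of_notMem (by simpa using hj.symm), zero_mul]
    · simp
  have hset : ∀ j, MeasurableSet (i t ⁻¹' {j}) := fun j => hi t (measurableSet_singleton j)
  have hterm : ∀ j, ∫ w, (i t ⁻¹' {j}).indicator (1 : S → ℝ) w *
      G (Function.update (fun t => i t w) t j) ∂P =
      p j * ∫ w, G (Function.update (fun t => i t w) t j) ∂P := by
    intro j
    obtain ⟨H, hH⟩ := DependsOn.exists_tuple (hGj j) (i 0 w₀)
    simp only [hH]
    have hm : Measurable fun w (r : Finset.range t) => i r w :=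
      measurable_pi_lambda _ fun r => hi r
    -- Once draw `t` is overwritten by `j`, the integrand depends on the draws before `t` only,
    -- hence is independent of the indicator.
    have h1 := hind.indepFun_finset {t} (Finset.range t) (by simp) hi
    have h2 : IndepFun (fun w => (i t ⁻¹' {j}).indicator (1 : S → ℝ) w)
        (fun w => H fun r : Finset.range t => i r w) P := by
      have := h1.comp (φ := fun v => ({j} : Set (Fin m)).indicator (1 : Fin m → ℝ)
        (v ⟨t, Finset.mem_singleton_self t⟩)) (ψ := H) (measurable_of_finite _)
        (measurable_of_finite _)
      exact this
    rw [h2.integral_fun_mul_eq_mul_integral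
      ((measurable_const.indicator (hset j)).aestronglyMeasurable)
      (((measurable_of_finite H).comp hm).aestronglyMeasurable), integral_indicator_one (hset j),
      Measure.real, hp, ENNReal.toReal_ofReal (hp0 j)]
  simp_rw [hsplit]
  rw [integral_finsetSum]
  · exact Finset.sum_congr rfl fun j _ => hterm j
  · intro j _
    have h := integrable_of_dependsOn (P := P) hi (hGj j)
    have := h.indicator (hset j)
    refine this.congr (Filter.Eventually.of_forall fun w => ?_)
    by_cases hw : w ∈ i t ⁻¹' {j}
    · simp [hw]
    · simp [hw]

end Draws

/-! ### Geometric weights and scalar estimates. -/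

section Sequences

/-- Division of the recursion by `α ^ (t + 1)` makes it telescope. -/
theorem sum_div_pow_add_le {e g : ℕ → ℝ} {α : ℝ} (hα : 0 < α)
    (H : ∀ t, e (t + 1) + g (t + 1) ≤ α * e t) (K : ℕ) :
    ∑ t ∈ Finset.Icc 1 K, 1 / α ^ t * g t + e K / α ^ K ≤ e 0 := by
  induction K with
  | zero => simp
  | succ K ih =>
    rw [Finset.sum_Icc_succ_top (by omega)]
    have h1 : (e (K + 1) + g (K + 1)) / α ^ (K + 1) ≤ e K / α ^ K := by
      rw [div_le_div_iff₀ (by positivity) (by positivity), pow_succ]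
      have := mul_le_mul_of_nonneg_right (H K) (pow_pos hα K).le
      linarith
    have h2 : (e (K + 1) + g (K + 1)) / α ^ (K + 1) =
        1 / α ^ (K + 1) * g (K + 1) + e (K + 1) / α ^ (K + 1) := by ring
    linarith

theorem sum_one_div_pow {α : ℝ} (hα : 0 < α) (K : ℕ) :
    (1 - α) * ∑ t ∈ Finset.Icc 1 K, 1 / α ^ t = 1 / α ^ K - 1 := by
  induction K with
  | zero => simp
  | succ K ih =>
    rw [Finset.sum_Icc_succ_top (by omega), mul_add, ih]
    field_simp
    ring

/-- The decay of the averaged gap, where `q = K (1 - α)`. -/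
theorem average_bound {q E a b : ℝ} (hq : 1 ≤ q) (hE : Real.exp q ≤ E) (ha : 0 ≤ a) (hb : 0 ≤ b) :
    a * (1 + b * q) / (E - 1) ≤ 2 * a * (1 + b) * Real.exp (-(q / 2)) := by
  -- Half of the exponent is spent on the factor linear in `q`.
  have h1 : q ≤ Real.exp (q / 2) := by
    have := Real.quadratic_le_exp_of_nonneg (show 0 ≤ q / 2 by linarith)
    nlinarith [sq_nonneg (q - 2)]
  have h2 : 2 ≤ Real.exp q := by linarith [Real.add_one_le_exp q]
  have h3 : Real.exp (q / 2) * Real.exp (-(q / 2)) = 1 := by rw [← Real.exp_add]; simp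
  have h4 : Real.exp q = Real.exp (q / 2) * Real.exp (q / 2) := by rw [← Real.exp_add]; ring_nf
  have hx := Real.exp_pos (q / 2)
  have hy := Real.exp_pos (-(q / 2))
  rw [div_le_iff₀ (by linarith)]
  calc a * (1 + b * q) ≤ a * ((1 + b) * Real.exp (q / 2)) := by
        apply mul_le_mul_of_nonneg_left _ ha
        nlinarith
    _ = 2 * a * (1 + b) * Real.exp (-(q / 2)) * (Real.exp q / 2) := by
        rw [h4]
        linear_combination (-(a * (1 + b) * Real.exp (q / 2))) * h3
    _ ≤ _ := by
        apply mul_le_mul_of_nonneg_left _ (by positivity)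
        linarith

end Sequences

/-! ### Expected gap of the averaged output. -/

section Convergence

variable {E : Type*} [NormedAddCommGroup E] [NormedSpace ℝ E] {m : ℕ}
  {X : Set E} {f : Fin m → E → ℝ} {h ω : E → ℝ} {L p : Fin m → ℝ} {μ τ η α : ℝ}

theorem Execution.dependsOn {τ η α : ℕ → ℝ} {x₀ : E} {s₀ : E →L[ℝ] ℝ}
    (A : Execution X f h ω μ p τ η α x₀ s₀) (F : State E m → ℝ) (t : ℕ) :
    DependsOn (fun ξ => F (A.state t ξ)) (Set.Iio t) := fun ξ ξ' hξ => by
  simp only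
  rw [A.nonanticipating t ξ ξ' hξ]

theorem Execution.average_dependsOn {τ η α : ℕ → ℝ} {x₀ : E} {s₀ : E →L[ℝ] ℝ}
    (A : Execution X f h ω μ p τ η α x₀ s₀) (θ : ℕ → ℝ) (F : E → ℝ) (K : ℕ) :
    DependsOn (fun ξ => F (A.average θ K ξ)) (Set.Iio K) := fun ξ ξ' hξ => by
  have : A.average θ K ξ = A.average θ K ξ' := by
    unfold Execution.average
    congr 1
    refine Finset.sum_congr rfl fun t ht => ?_
    rw [A.nonanticipating t ξ ξ' fun r hr => hξ r (hr.trans_le (Finset.mem_Icc.1 ht).2)]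
  simp only [this]

theorem Execution.integral_lyapunov_succ_le {S : Type*} [MeasurableSpace S] {P : Measure S}
    [IsProbabilityMeasure P] {i : ℕ → S → Fin m} (hi : ∀ t, Measurable (i t))
    (hind : iIndepFun i P) (hP : ∀ t j, P (i t ⁻¹' {j}) = ENNReal.ofReal (p j))
    (hp : Admissible L p μ τ η α)
    (hf : ∀ i, ConvexOn ℝ Set.univ (f i)) (hd : ∀ i, Differentiable ℝ (f i))
    (hL : ∀ i x x', ‖fderiv ℝ (f i) x - fderiv ℝ (f i) x'‖ ≤ L i * ‖x - x'‖)
    (hω : StrongConvexOn X 1 ω) {x₀ : E} {s₀ : E →L[ℝ] ℝ} (hx₀ : x₀ ∈ X)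
    (hs₀ : s₀ ∈ subdiffOn X ω x₀) {u : E} (hu : u ∈ X)
    (A : Execution X f h ω μ p (fun _ => τ) (fun _ => η) (fun _ => α) x₀ s₀) (t : ℕ) :
    ∫ w, lyapunov f ω p μ τ η u (A.state (t + 1) fun r => i r w) ∂P +
      ∫ w, linearizedGap f h ω μ u (A.state (t + 1) fun r => i r w).x ∂P ≤
      α * ∫ w, lyapunov f ω p μ τ η u (A.state t fun r => i r w) ∂P := by
  let F : State E m → ℝ := fun s => lyapunov f ω p μ τ η u s + linearizedGap f h ω μ u s.x
  have hint : ∀ (F : State E m → ℝ) t, Integrable (fun w => F (A.state t fun r => i r w)) P :=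
    fun F t => integrable_of_dependsOn hi (A.dependsOn F t)
  rw [← integral_add (hint (lyapunov f ω p μ τ η u) (t + 1))
    (hint (fun s => linearizedGap f h ω μ u s.x) (t + 1))]
  change ∫ w, F (A.state (t + 1) fun r => i r w) ∂P ≤ _
  rw [integral_eq_sum_prob hi hind (fun j => (hp.prob_pos j).le) hP (A.dependsOn F (t + 1))]
  have hGj : ∀ j, Integrable
      (fun w => F (A.state (t + 1) (Function.update (fun r => i r w) t j))) P := by
    intro j
    refine integrable_of_dependsOn (G := fun ξ => F (A.state (t + 1) (Function.update ξ t j)))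
      (t := t) hi fun ξ ξ' hξ => ?_
    apply A.dependsOn F (t + 1)
    intro r hr
    rcases eq_or_ne r t with rfl | hrt
    · simp
    · rw [Function.update_of_ne hrt, Function.update_of_ne hrt]
      exact hξ r (lt_of_le_of_ne (Nat.lt_succ_iff.1 hr) hrt)
  simp_rw [← integral_const_mul]
  rw [← integral_finsetSum _ fun j _ => (hGj j).const_mul _]
  refine integral_mono (integrable_finsetSum _ fun j _ => (hGj j).const_mul _)
    ((hint _ t).const_mul α) fun w => ?_
  refine sum_prob_mul_lyapunov_le hp hf hd hL hω hu
    (A.consistent hf hd hL (fun _ => by linarith [hp.tau_pos]) hx₀ hs₀ t _) fun j => ?_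
  -- Overwriting draw `t` leaves the state after `t` iterations unchanged, so the `m` overwritten
  -- sequences give all possible steps from one state.
  have hstep := A.step t (Function.update (fun r => i r w) t j)
  rw [Function.update_self, A.nonanticipating t (Function.update (fun r => i r w) t j)
    (fun r => i r w) fun r hr => Function.update_of_ne hr.ne _ _] at hstep
  exact hstep

theorem convexOn_objective (hf : ∀ i, ConvexOn ℝ Set.univ (f i)) (hh : ConvexOn ℝ X h)
    (hω : ConvexOn ℝ X ω) (hμ : 0 ≤ μ) : ConvexOn ℝ X (objective f h ω μ) := by
  have h1 : ConvexOn ℝ X (fun x => ∑ i, f i x) := by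
    have := Finset.sum_induction (s := Finset.univ) f (fun g => ConvexOn ℝ X g) (fun _ _ => ConvexOn.add)
      (convexOn_const 0 hh.1) fun i _ => (hf i).subset (Set.subset_univ X) hh.1
    convert this using 1
    funext x
    simp
  exact (h1.add hh).add (hω.smul hμ)

theorem Execution.average_mem {τ η α : ℕ → ℝ} {x₀ : E} {s₀ : E →L[ℝ] ℝ} (hX : Convex ℝ X)
    (hmem : x₀ ∈ X) (A : Execution X f h ω μ p τ η α x₀ s₀) {θ : ℕ → ℝ} (hθ : ∀ t, 0 < θ t)
    {K : ℕ} (hK : 1 ≤ K) (ξ : ℕ → Fin m) : A.average θ K ξ ∈ X := by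
  have hxt : ∀ t, (A.state t ξ).x ∈ X := by
    intro t
    cases t with
    | zero => rw [A.initial]; exact hmem
    | succ t => exact (A.step t ξ).primal_prox.mem
  have hpos : 0 < ∑ t ∈ Finset.Icc 1 K, θ t :=
    Finset.sum_pos (fun t _ => hθ t) ⟨1, by simp [hK]⟩
  have := hX.centerMass_mem (t := Finset.Icc 1 K) (w := θ) (z := fun t => (A.state t ξ).x)
    (fun t _ => (hθ t).le) hpos fun t _ => hxt t
  simpa [Execution.average, Finset.centerMass] using this

/-- The gap of the problem at the averaged output is at most the average of the gaps. -/
theorem Execution.average_gap_le {τ η α : ℕ → ℝ} {x₀ : E} {s₀ : E →L[ℝ] ℝ} {Ψ : E → ℝ}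
    (hΨ : ConvexOn ℝ X Ψ) (A : Execution X f h ω μ p τ η α x₀ s₀)
    {θ : ℕ → ℝ} (hθ : ∀ t, 0 < θ t) {K : ℕ} (hK : 1 ≤ K) (ξ : ℕ → Fin m) (u : E) :
    Ψ (A.average θ K ξ) - Ψ u ≤ (∑ t ∈ Finset.Icc 1 K, θ t)⁻¹ *
      ∑ t ∈ Finset.Icc 1 K, θ t * (Ψ (A.state t ξ).x - Ψ u) := by
  have hpos : 0 < ∑ t ∈ Finset.Icc 1 K, θ t :=
    Finset.sum_pos (fun t _ => hθ t) ⟨1, by simp [hK]⟩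
  have h1 := hΨ.map_centerMass_le (t := Finset.Icc 1 K) (w := θ)
    (p := fun t => (A.state t ξ).x) (fun t _ => (hθ t).le) hpos fun t ht => by
      obtain ⟨s, rfl⟩ : ∃ s, t = s + 1 := ⟨t - 1, by have := (Finset.mem_Icc.1 ht).1; omega⟩
      exact (A.step s ξ).primal_prox.mem
  simp only [Finset.centerMass, smul_eq_mul, Function.comp_apply] at h1
  simp only [mul_sub, Finset.sum_sub_distrib, ← Finset.sum_mul]
  rw [inv_mul_cancel_left₀ hpos.ne']
  exact sub_le_sub_right h1 _

/-- Expected gap at the output of the method in the strongly convex case. -/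
theorem Execution.integral_average_gap_le {S : Type*} [MeasurableSpace S] {P : Measure S}
    [IsProbabilityMeasure P] {i : ℕ → S → Fin m} (hi : ∀ t, Measurable (i t))
    (hind : iIndepFun i P) (hP : ∀ t j, P (i t ⁻¹' {j}) = ENNReal.ofReal (prob L j))
    (hμ : 0 < μ) (hL0 : ∀ i, 0 ≤ L i) (hLpos : 0 < ∑ i, L i)
    (hf : ∀ i, ConvexOn ℝ Set.univ (f i)) (hd : ∀ i, Differentiable ℝ (f i))
    (hL : ∀ i x x', ‖fderiv ℝ (f i) x - fderiv ℝ (f i) x'‖ ≤ L i * ‖x - x'‖)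
    {Lf : ℝ} (hLf0 : 0 ≤ Lf)
    (hLf : ∀ x x', ‖∑ i, fderiv ℝ (f i) x - ∑ i, fderiv ℝ (f i) x'‖ ≤ Lf * ‖x - x'‖)
    (hh : ConvexOn ℝ X h) (hω : StrongConvexOn X 1 ω) {x₀ : E} {s₀ : E →L[ℝ] ℝ} (hx₀ : x₀ ∈ X)
    (hs₀ : s₀ ∈ subdiffOn X ω x₀) {u : E} (hu : u ∈ X)
    (hgap : ∀ x ∈ X, 0 ≤ linearizedGap f h ω μ u x) {R : ℝ} (hR : bregman ω s₀ x₀ u ≤ R ^ 2)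
    (A : Execution X f h ω μ (prob L) (fun _ => tau μ L) (fun _ => eta μ L)
      (fun _ => alpha μ L) x₀ s₀) {K : ℕ} (hK : 1 ≤ K * (1 - alpha μ L)) :
    ∫ w, (objective f h ω μ (A.average (fun t => 1 / alpha μ L ^ t) K fun r => i r w) -
        objective f h ω μ u) ∂P ≤
      4 / μ * (μ / 2 + Lf) ^ 2 * R ^ 2 * Real.exp (-(K * (1 - alpha μ L) / 2)) := by
  have hp := admissible hμ hL0 hLpos
  have hα0 := alpha_pos hLpos μ
  have hα1 := one_sub_alpha_pos L μ
  have hαη := one_sub_alpha_mul_mu_add_eta μ L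
  have hinit := lyapunov_initial_le hμ hf hd hL0 hLpos hL hLf0 hLf hω hx₀ hu hs₀ hR
  revert A hK hp hα0 hα1 hαη hinit
  -- From here only the admissibility relations, the identity for `μ + η` and the initial bound are
  -- used, not the formulas for the parameters.
  generalize alpha μ L = α
  generalize tau μ L = τ
  generalize eta μ L = η
  intro A hK hp hα0 hα1 hαη hinit
  have hK1 : 1 ≤ K := by
    by_contra! h0
    have : K = 0 := by omega
    subst this
    norm_num at hK
  let e : ℕ → ℝ := fun t => ∫ w, lyapunov f ω (prob L) μ τ η u (A.state t fun r => i r w) ∂P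
  let g : ℕ → ℝ := fun t => ∫ w, linearizedGap f h ω μ u (A.state t fun r => i r w).x ∂P
  have hint : ∀ (F : State E m → ℝ) t, Integrable (fun w => F (A.state t fun r => i r w)) P :=
    fun F t => integrable_of_dependsOn hi (A.dependsOn F t)
  have hcons : ∀ t ξ, Consistent X f ω (A.state t ξ) := fun t ξ =>
    A.consistent hf hd hL (fun _ => by linarith [hp.tau_pos]) hx₀ hs₀ t ξ
  have hg0 : ∀ t, 0 ≤ g t := fun t => integral_nonneg fun w => hgap _ (hcons t _).mem
  have hrec : ∀ t, e (t + 1) + g (t + 1) ≤ α * e t := fun t =>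
    A.integral_lyapunov_succ_le hi hind hP hp hf hd hL hω hx₀ hs₀ hu t
  have hlow := fun s => lyapunov_ge (ω := ω) hp hf hd hL0 hL u s
  have hμη : 0 < μ + η := by linarith [hp.eta_nonneg]
  have he0 : ∀ t, 0 ≤ e t := fun t => integral_nonneg fun w =>
    (mul_nonneg hμη.le (bregman_nonneg (hcons t _).subgradient hu)).trans (hlow _)
  have hdec : ∀ t, 1 / α ^ t * e t ≤ e 0 := by
    intro t
    have h1 := sum_div_pow_add_le hα0 hrec t
    have h2 : 0 ≤ ∑ t ∈ Finset.Icc 1 t, 1 / α ^ t * g t :=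
      Finset.sum_nonneg fun r _ => mul_nonneg (by positivity) (hg0 r)
    have h3 : 1 / α ^ t * e t = e t / α ^ t := by ring
    linarith
  have hsumg : ∑ t ∈ Finset.Icc 1 K, 1 / α ^ t * g t ≤ e 0 := by
    have h1 := sum_div_pow_add_le hα0 hrec K
    have : 0 ≤ e K / α ^ K := div_nonneg (he0 K) (by positivity)
    linarith
  have hV0 : (1 - α) * e 0 ≤ (μ / 2 + Lf) * R ^ 2 := by
    have h1 : e 0 = lyapunov f ω (prob L) μ τ η u (initialState f x₀ s₀) := by
      simp only [e, A.initial]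
      simp
    rw [h1]
    exact hinit
  have hfd : ∀ x, fderiv ℝ (fun y => ∑ i, f i y) x = ∑ i, fderiv ℝ (f i) x := fun x =>
    fderiv_fun_sum fun i _ => hd i x
  -- The linearization error `Lf / 2 ‖x - u‖²` is at most `Lf P(x, u)`, which the Lyapunov function
  -- dominates.
  have hpt : ∀ t ξ, objective f h ω μ (A.state t ξ).x - objective f h ω μ u ≤
      linearizedGap f h ω μ u (A.state t ξ).x +
        Lf / (μ + η) * lyapunov f ω (prob L) μ τ η u (A.state t ξ) := by
    intro t ξ
    set s := A.state t ξ
    have hc := hcons t ξ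
    have h1 := linGap_le (f := fun y => ∑ i, f i y) (Differentiable.fun_sum fun i _ => hd i)
      (fun x x' => by rw [hfd, hfd]; exact hLf x x') u s.x
    have h2 := bregman_ge hω hc.mem hc.subgradient hu
    have h3 := mul_le_mul_of_nonneg_left ((le_div_iff₀' hμη).2 (hlow s)) hLf0
    have h4 := mul_le_mul_of_nonneg_left h2 hLf0
    rw [norm_sub_rev] at h4
    have h5 : Lf / (μ + η) * lyapunov f ω (prob L) μ τ η u s =
      Lf * (lyapunov f ω (prob L) μ τ η u s / (μ + η)) := by ring
    rw [h5]
    simp only [linGap, hfd] at h1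
    simp only [objective, linearizedGap]
    linarith
  have hΨ : ConvexOn ℝ X (objective f h ω μ) :=
    convexOn_objective hf hh (hω.convexOn (by intro r; positivity)) hμ.le
  have hθ : ∀ t, 0 < 1 / α ^ t := fun t => by positivity
  have hsumpos : 0 < ∑ t ∈ Finset.Icc 1 K, 1 / α ^ t :=
    Finset.sum_pos (fun t _ => hθ t) ⟨1, by simp [hK1]⟩
  have hmain : ∫ w, (objective f h ω μ (A.average (fun t => 1 / α ^ t) K fun r => i r w) -
        objective f h ω μ u) ∂P ≤ (∑ t ∈ Finset.Icc 1 K, 1 / α ^ t)⁻¹ *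
        ∑ t ∈ Finset.Icc 1 K, 1 / α ^ t * (g t + Lf / (μ + η) * e t) := by
    have h1 : ∀ t, g t + Lf / (μ + η) * e t = ∫ w, (linearizedGap f h ω μ u
        (A.state t fun r => i r w).x + Lf / (μ + η) *
          lyapunov f ω (prob L) μ τ η u (A.state t fun r => i r w)) ∂P := by
      intro t
      rw [integral_add (hint (fun s => linearizedGap f h ω μ u s.x) t)
        ((hint (lyapunov f ω (prob L) μ τ η u) t).const_mul _), integral_const_mul]
    have hI : ∀ t, Integrable (fun w => linearizedGap f h ω μ u
        (A.state t fun r => i r w).x + Lf / (μ + η) *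
          lyapunov f ω (prob L) μ τ η u (A.state t fun r => i r w)) P := fun t =>
      (hint (fun s => linearizedGap f h ω μ u s.x) t).add
        ((hint (lyapunov f ω (prob L) μ τ η u) t).const_mul _)
    simp_rw [h1, ← integral_const_mul]
    rw [← integral_finsetSum _ fun t _ => (hI t).const_mul _, ← integral_const_mul]
    refine integral_mono (integrable_of_dependsOn hi (A.average_dependsOn _
      (fun x => objective f h ω μ x - objective f h ω μ u) K))
      ((integrable_finsetSum _ fun t _ => (hI t).const_mul _).const_mul _) fun w => ?_
    refine (A.average_gap_le hΨ hθ hK1 _ u).trans ?_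
    refine mul_le_mul_of_nonneg_left ?_ (inv_pos.2 hsumpos).le
    exact Finset.sum_le_sum fun t _ => mul_le_mul_of_nonneg_left (hpt t _) (hθ t).le
  have hsum : ∑ t ∈ Finset.Icc 1 K, 1 / α ^ t * (g t + Lf / (μ + η) * e t) ≤
      e 0 + K * (Lf / (μ + η) * e 0) := by
    have h1 : ∑ t ∈ Finset.Icc 1 K, Lf / (μ + η) * (1 / α ^ t * e t) ≤
        ∑ t ∈ Finset.Icc 1 K, Lf / (μ + η) * e 0 :=
      Finset.sum_le_sum fun t _ => mul_le_mul_of_nonneg_left (hdec t) (by positivity)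
    rw [Finset.sum_const, Nat.card_Icc, Nat.add_sub_cancel, nsmul_eq_mul] at h1
    have h2 : ∑ t ∈ Finset.Icc 1 K, 1 / α ^ t * (g t + Lf / (μ + η) * e t) =
        ∑ t ∈ Finset.Icc 1 K, 1 / α ^ t * g t +
        ∑ t ∈ Finset.Icc 1 K, Lf / (μ + η) * (1 / α ^ t * e t) := by
      rw [← Finset.sum_add_distrib]
      exact Finset.sum_congr rfl fun t _ => by ring
    linarith
  set q := K * (1 - α) with hq
  -- The factor `1 - α` turns the `K` of the accumulated linearization errors into `q`.
  have hratio : Lf / (μ + η) = 2 * Lf / μ * (1 - α) := by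
    rw [div_eq_iff hμη.ne', mul_assoc, hαη]
    field_simp
  have hexp : Real.exp q ≤ 1 / α ^ K := by
    have h1 : α ≤ Real.exp (-(1 - α)) := by linarith [Real.add_one_le_exp (-(1 - α))]
    have h2 : α ^ K ≤ Real.exp (-q) := by
      refine (pow_le_pow_left₀ hα0.le h1 K).trans (le_of_eq ?_)
      rw [← Real.exp_nat_mul, hq]
      ring_nf
    rw [Real.exp_neg] at h2
    rw [one_div]
    exact (le_inv_comm₀ (pow_pos hα0 K) (Real.exp_pos q)).1 h2
  have hgeo := sum_one_div_pow hα0 K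
  have hge1 : 0 < 1 / α ^ K - 1 := by rw [← hgeo]; positivity
  have hE0 := he0 0
  calc _ ≤ _ := hmain
    _ ≤ (∑ t ∈ Finset.Icc 1 K, 1 / α ^ t)⁻¹ * (e 0 + K * (Lf / (μ + η) * e 0)) :=
        mul_le_mul_of_nonneg_left hsum (inv_pos.2 hsumpos).le
    _ = ((1 - α) * e 0) * (1 + 2 * Lf / μ * q) / (1 / α ^ K - 1) := by
        rw [← hgeo, hratio, hq]
        field_simp
    _ ≤ ((μ / 2 + Lf) * R ^ 2) * (1 + 2 * Lf / μ * q) / (1 / α ^ K - 1) := by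
        gcongr
    _ ≤ 2 * ((μ / 2 + Lf) * R ^ 2) * (1 + 2 * Lf / μ) * Real.exp (-(q / 2)) :=
        average_bound hK hexp (by positivity) (by positivity)
    _ = _ := by
        field_simp
        ring

end Convergence

/-! ### From the decay rate to the iteration count. -/

section Complexity

/-- For this modulus `4 m C = 64 m (∑ L) R² / ε`, and `√(a² + b²) ≤ a + b` for `a, b ≥ 0`. -/
theorem inv_one_sub_alpha_le {m : ℕ} {L : Fin m → ℝ} {R ε : ℝ} (hL : 0 < ∑ i, L i) (hR : 0 < R)
    (hε : 0 < ε) :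
    (1 - alpha (ε / (2 * R ^ 2)) L)⁻¹ ≤ 8 * (m + √(m * (∑ j, L j) * R ^ 2 / ε)) := by
  have hm := one_le_of_sum_pos hL
  rw [one_sub_alpha, inv_inv]
  have h1 : root (ε / (2 * R ^ 2)) L ≤ ((m : ℝ) - 1) + 8 * √(m * (∑ j, L j) * R ^ 2 / ε) := by
    apply Real.sqrt_le_iff.2
    have hs : 0 ≤ √(m * (∑ j, L j) * R ^ 2 / ε) := Real.sqrt_nonneg _
    refine ⟨by linarith, ?_⟩
    have h2 : √(m * (∑ j, L j) * R ^ 2 / ε) ^ 2 = m * (∑ j, L j) * R ^ 2 / ε :=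
      Real.sq_sqrt (by positivity)
    have h3 : 4 * (m : ℝ) * (8 * (∑ j, L j) / (ε / (2 * R ^ 2))) =
        64 * √(m * (∑ j, L j) * R ^ 2 / ε) ^ 2 := by
      rw [h2]
      field_simp
      ring
    rw [h3]
    nlinarith [mul_nonneg (sub_nonneg.2 hm) hs]
  linarith

theorem strongConvexOn_add_mul {E : Type*} [NormedAddCommGroup E] [NormedSpace ℝ E] {X : Set E}
    {h ω : E → ℝ} {δ : ℝ} (hδ : 0 ≤ δ) (hh : ConvexOn ℝ X h) (hω : StrongConvexOn X 1 ω) :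
    StrongConvexOn X δ fun x => h x + δ * ω x := by
  refine ⟨hh.1, fun x hx y hy a b ha hb hab => ?_⟩
  have h1 := hh.2 hx hy ha hb hab
  have h2 := mul_le_mul_of_nonneg_left (hω.2 hx hy ha hb hab) hδ
  simp only [smul_eq_mul] at *
  linarith

theorem isCompact_of_bregman_le {E : Type*} [NormedAddCommGroup E] [NormedSpace ℝ E]
    [FiniteDimensional ℝ E] {X : Set E} (hX : IsClosed X) {ω : E → ℝ} (hω : StrongConvexOn X 1 ω)
    {x₀ : E} {s₀ : E →L[ℝ] ℝ} (hx₀ : x₀ ∈ X) (hs₀ : s₀ ∈ subdiffOn X ω x₀) {M : ℝ}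
    (hM : ∀ x ∈ X, bregman ω s₀ x₀ x ≤ M) : IsCompact X := by
  refine Metric.isCompact_of_isClosed_isBounded hX
    (Metric.isBounded_closedBall (x := x₀) (r := √(2 * M)) |>.subset fun x hx => ?_)
  rw [mem_closedBall_iff_norm]
  apply Real.le_sqrt_of_sq_le
  linarith [bregman_ge hω hx₀ hs₀ hx, hM x hx]

/-- The error constant of the strongly convex case is absorbed by the exponential decay. -/
theorem error_bound {m Lf R ε B lam q : ℝ} (hm : 1 ≤ m) (hLf : 0 ≤ Lf) (hR : 0 < R) (hε : 0 < ε)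
    (hB : B = max (max 2 R) (m * Lf * R / ε)) (hlam : 0 < lam) (hlam1 : lam ≤ 1)
    (hq : 18 * Real.log (B / lam) ≤ q) :
    4 / (ε / (2 * R ^ 2)) * (ε / (2 * R ^ 2) / 2 + Lf) ^ 2 * R ^ 2 * Real.exp (-(q / 2)) ≤
      ε / 2 * lam := by
  have hB2 : 2 ≤ B := by rw [hB]; exact le_max_of_le_left (le_max_left _ _)
  have hBR : R ≤ B := by rw [hB]; exact le_max_of_le_left (le_max_right _ _)
  have hBL : m * Lf * R / ε ≤ B := by rw [hB]; exact le_max_right _ _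
  have hB0 : 0 < B := by linarith
  have h1 : Lf * R ^ 2 / ε ≤ B ^ 2 := by
    calc Lf * R ^ 2 / ε = 1 * Lf * R / ε * R := by ring
      _ ≤ m * Lf * R / ε * R := by gcongr
      _ ≤ B * B := by gcongr
      _ = B ^ 2 := by ring
  have h2 : 4 / (ε / (2 * R ^ 2)) * (ε / (2 * R ^ 2) / 2 + Lf) ^ 2 * R ^ 2 =
      8 * ε * (1 / 4 + Lf * R ^ 2 / ε) ^ 2 := by
    field_simp
    ring
  have h3 : 8 * ε * (1 / 4 + Lf * R ^ 2 / ε) ^ 2 ≤ 10 * ε * B ^ 4 := by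
    have h4 : 1 / 4 + Lf * R ^ 2 / ε ≤ 17 / 16 * B ^ 2 := by nlinarith
    calc 8 * ε * (1 / 4 + Lf * R ^ 2 / ε) ^ 2 ≤ 8 * ε * (17 / 16 * B ^ 2) ^ 2 := by gcongr
      _ = 289 / 32 * (ε * B ^ 4) := by ring
      _ ≤ 10 * (ε * B ^ 4) := by gcongr; norm_num
      _ = _ := by ring
  -- The exponent `9 = 18 / 2` leaves `B⁻⁵` after cancelling `B⁴`, and `B ≥ 2` makes `10 / B⁵` at
  -- most `1 / 2`.
  have h5 : Real.exp (-(q / 2)) ≤ (lam / B) ^ 9 := by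
    have h6 : 0 < B / lam := by positivity
    have h7 : Real.exp (-(9 * Real.log (B / lam))) = (lam / B) ^ 9 := by
      rw [← mul_neg, ← Real.log_inv, inv_div]
      have : (9 : ℝ) = ((9 : ℕ) : ℝ) := by norm_num
      rw [this, Real.exp_nat_mul, Real.exp_log (by positivity)]
    rw [← h7]
    apply Real.exp_le_exp.2
    linarith
  have h8 : (lam / B) ^ 9 ≤ lam / B ^ 9 := by
    rw [div_pow]
    gcongr
    calc lam ^ 9 ≤ lam ^ 1 := pow_le_pow_of_le_one hlam.le hlam1 (by norm_num)
      _ = lam := pow_one _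
  have h9 : 10 * ε * B ^ 4 * (lam / B ^ 9) = ε * lam * (10 / B ^ 5) := by
    field_simp
  have h10 : 10 / B ^ 5 ≤ 1 / 2 := by
    rw [div_le_div_iff₀ (by positivity) (by norm_num)]
    have : (2 : ℝ) ^ 5 ≤ B ^ 5 := by gcongr
    linarith
  rw [h2]
  calc _ ≤ 10 * ε * B ^ 4 * (lam / B ^ 9) := by
        gcongr
        exact h5.trans h8
    _ = ε * lam * (10 / B ^ 5) := h9
    _ ≤ ε * lam * (1 / 2) := by gcongr
    _ = _ := by ring

end Complexity

end RPDG

/-! ### The complexity statement. -/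

theorem proposition4p1 :
    ∃ c : ℝ, 0 < c ∧
    ∀ (E : Type*) [NormedAddCommGroup E] [NormedSpace ℝ E] [FiniteDimensional ℝ E]
      (m : ℕ) (X : Set E) (f : Fin m → E → ℝ) (h ω : E → ℝ) (L : Fin m → ℝ) (Lf : ℝ)
      (x₀ : E) (s₀ : E →L[ℝ] ℝ) (R ε : ℝ),
      IsClosed X → Convex ℝ X →
      -- the components are smooth convex functions
      (∀ i, ConvexOn ℝ Set.univ (f i)) → (∀ i, Differentiable ℝ (f i)) →
      (∀ i, 0 ≤ L i) → 0 < ∑ i, L i →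
      (∀ i x x', ‖fderiv ℝ (f i) x - fderiv ℝ (f i) x'‖ ≤ L i * ‖x - x'‖) →
      0 ≤ Lf → Lf ≤ ∑ i, L i →
      (∀ x x', ‖∑ i, fderiv ℝ (f i) x - ∑ i, fderiv ℝ (f i) x'‖ ≤ Lf * ‖x - x'‖) →
      -- the simple term is convex, and the prox-function is strongly convex with modulus one
      ConvexOn ℝ X h → StrongConvexOn X 1 ω →
      -- the prox-mappings are defined
      (∀ (g : E →L[ℝ] ℝ) (γ : ℝ), 0 < γ →
        ∃ x ∈ X, IsMinOn (fun u => g u + h u + γ * ω u) X x) →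
      -- starting point and Bregman radius
      x₀ ∈ X → s₀ ∈ RPDG.subdiffOn X ω x₀ →
      0 < R → (∀ x ∈ X, RPDG.bregman ω s₀ x₀ x ≤ R ^ 2) →
      0 < ε →
      -- the method can be executed, and every execution has the claimed complexity
      Nonempty (RPDG.PerturbedExecution X f h ω L (ε / (2 * R ^ 2)) x₀ s₀) ∧
      ∀ (A : RPDG.PerturbedExecution X f h ω L (ε / (2 * R ^ 2)) x₀ s₀)
        (S : Type*) [MeasurableSpace S] (P : MeasureTheory.Measure S)
        [MeasureTheory.IsProbabilityMeasure P] (i : ℕ → S → Fin m),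
        (∀ t, Measurable (i t)) → ProbabilityTheory.iIndepFun i P →
        (∀ t j, P (i t ⁻¹' {j}) = ENNReal.ofReal (RPDG.prob L j)) →
        ∀ K : ℕ,
          (c * ((m + √(m * (∑ j, L j) * R ^ 2 / ε)) *
              Real.log (max (max 2 R) (m * Lf * R / ε))) ≤ K →
            (∀ ξ, A.output K ξ ∈ X) ∧
            MeasureTheory.Integrable (fun w =>
              RPDG.objective f h ω 0 (A.output K fun t => i t w)
                - sInf (RPDG.objective f h ω 0 '' X)) P ∧
            ∫ w, (RPDG.objective f h ω 0 (A.output K fun t => i t w)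
                - sInf (RPDG.objective f h ω 0 '' X)) ∂P ≤ ε) ∧
          (∀ lam : ℝ, 0 < lam → lam < 1 →
            c * ((m + √(m * (∑ j, L j) * R ^ 2 / ε)) *
              Real.log (max (max 2 R) (m * Lf * R / ε) / lam)) ≤ K →
            (∀ ξ, A.output K ξ ∈ X) ∧
            P.real {w | ε < RPDG.objective f h ω 0 (A.output K fun t => i t w)
                - sInf (RPDG.objective f h ω 0 '' X)} ≤ lam) := by
  -- `144 = 8 · 18`: the bound on `(1 - α)⁻¹` times the multiple of the logarithm asked by
  -- `error_bound`.
  refine ⟨144, by norm_num, ?_⟩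
  intro E _ _ _ m X f h ω L Lf x₀ s₀ R ε hXc hXconv hf hd hL0 hLpos hL hLf0 _ hLf hh hω hatt hx₀
    hs₀ hR hbr hε
  have hm := RPDG.one_le_of_sum_pos hLpos
  set δ := ε / (2 * R ^ 2) with hδdef
  have hδ : 0 < δ := by positivity
  have hδR : δ * R ^ 2 = ε / 2 := by rw [hδdef]; field_simp
  have hωc : ConvexOn ℝ X ω := hω.convexOn (by intro r; positivity)
  have hp := RPDG.admissible hδ hL0 hLpos
  have hh' : ConvexOn ℝ X (RPDG.perturbed h ω δ x₀ s₀) := RPDG.convexOn_perturbed hh δ x₀ s₀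
  have hatt' := RPDG.exists_isMinOn_perturbed hatt δ x₀ s₀
  refine ⟨RPDG.nonempty_execution fun t j S => RPDG.exists_isStep hf hd hL hh' hωc hatt'
    (by linarith [hp.tau_pos]) (by linarith [hp.eta_nonneg]) j S, ?_⟩
  intro A S _ P _ i hi hind hP K
  have hfd : ∀ x, fderiv ℝ (fun y => ∑ i, f i y) x = ∑ i, fderiv ℝ (f i) x := fun x =>
    fderiv_fun_sum fun i _ => hd i x
  have hfsum : ConvexOn ℝ Set.univ fun y => ∑ i, f i y := by
    have := RPDG.convexOn_objective (h := fun _ : E => 0) (ω := fun _ : E => 0) hf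
      (convexOn_const 0 convex_univ) (convexOn_const 0 convex_univ) le_rfl
    convert this using 1
    funext x
    simp [RPDG.objective]
  obtain ⟨u, hu, humin⟩ := RPDG.exists_linearized_min
    (RPDG.isCompact_of_bregman_le hXc hω hx₀ hs₀ hbr) ⟨x₀, hx₀⟩ hδ hfsum
    (Differentiable.fun_sum fun i _ => hd i) (fun x x' => by rw [hfd, hfd]; exact hLf x x')
    (RPDG.strongConvexOn_add_mul hδ.le hh' hω) fun g => by
      obtain ⟨x, hx, hmin⟩ := hatt' g δ hδ
      exact ⟨x, hx, by simpa only [add_assoc] using hmin⟩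
  have hgap : ∀ x ∈ X, 0 ≤ RPDG.linearizedGap f (RPDG.perturbed h ω δ x₀ s₀) ω δ u x := by
    intro x hx
    have := humin x hx
    rw [hfd] at this
    simp only [RPDG.linearizedGap, map_sub]
    linarith
  have humin' : ∀ x ∈ X, RPDG.objective f (RPDG.perturbed h ω δ x₀ s₀) ω δ u ≤
      RPDG.objective f (RPDG.perturbed h ω δ x₀ s₀) ω δ x := by
    intro x hx
    have h1 := hgap x hx
    have h2 := Finset.sum_nonneg fun i (_ : i ∈ Finset.univ) =>
      RPDG.linGap_nonneg (hf i) (hd i) (hL i) u x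
    simp only [RPDG.linGap, Finset.sum_sub_distrib, ← sum_apply] at h2
    simp only [RPDG.linearizedGap] at h1
    simp only [RPDG.objective]
    linarith
  have hcomp : ∀ x ∈ X, RPDG.objective f h ω 0 x ≤
      RPDG.objective f (RPDG.perturbed h ω δ x₀ s₀) ω δ x ∧
      RPDG.objective f (RPDG.perturbed h ω δ x₀ s₀) ω δ x ≤
        RPDG.objective f h ω 0 x + ε / 2 := by
    intro x hx
    rw [RPDG.objective_perturbed]
    have h1 := mul_nonneg hδ.le (RPDG.bregman_nonneg hs₀ hx)
    have h2 := mul_le_mul_of_nonneg_left (hbr x hx) hδ.le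
    simp only [RPDG.objective]
    constructor <;> linarith
  have hinf : RPDG.objective f (RPDG.perturbed h ω δ x₀ s₀) ω δ u - ε / 2 ≤
      sInf (RPDG.objective f h ω 0 '' X) := by
    apply le_csInf (Set.Nonempty.image _ ⟨x₀, hx₀⟩)
    rintro _ ⟨x, hx, rfl⟩
    linarith [humin' x hx, (hcomp x hx).2]
  have hαpos := RPDG.one_sub_alpha_pos L δ
  have hinv := RPDG.inv_one_sub_alpha_le (L := L) hLpos hR hε
  set B := max (max 2 R) (m * Lf * R / ε) with hB
  have hB2 : 2 ≤ B := le_max_of_le_left (le_max_left _ _)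
  have hmain : ∀ lam : ℝ, 0 < lam → lam ≤ 1 →
      144 * ((m + √(m * (∑ j, L j) * R ^ 2 / ε)) * Real.log (B / lam)) ≤ K →
      (∀ ξ, A.output K ξ ∈ X) ∧
      ∫ w, (RPDG.objective f (RPDG.perturbed h ω δ x₀ s₀) ω δ (A.output K fun t => i t w) -
        RPDG.objective f (RPDG.perturbed h ω δ x₀ s₀) ω δ u) ∂P ≤ ε / 2 * lam := by
    intro lam hlam hlam1 hK
    -- Keeps the logarithm above `1 / 2`, so that `K (1 - α) ≥ 9` and in particular `K ≥ 1`.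
    have hlog : Real.log 2 ≤ Real.log (B / lam) := by
      apply Real.log_le_log (by norm_num)
      rw [le_div_iff₀ hlam]
      nlinarith
    have hlog2 : 1 / 2 < Real.log 2 := by linarith [Real.log_two_gt_d9]
    have hq : 18 * Real.log (B / lam) ≤ K * (1 - RPDG.alpha δ L) := by
      rw [inv_le_iff_one_le_mul₀ hαpos] at hinv
      have h1 := mul_le_mul_of_nonneg_right hK hαpos.le
      have h2 : 0 ≤ Real.log (B / lam) := by linarith
      nlinarith [mul_le_mul_of_nonneg_right hinv h2]
    have hq1 : 1 ≤ K * (1 - RPDG.alpha δ L) := by linarith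
    have hK1 : 1 ≤ K := by
      by_contra! h0
      have : K = 0 := by omega
      subst this
      norm_num at hq1
    have hα := RPDG.alpha_pos hLpos δ
    refine ⟨fun ξ => RPDG.Execution.average_mem hXconv hx₀ A (fun t => by positivity) hK1 ξ, ?_⟩
    exact (RPDG.Execution.integral_average_gap_le hi hind hP hδ hL0 hLpos hf hd hL hLf0 hLf hh' hω
      hx₀ hs₀ hu hgap (hbr u hu) A hq1).trans
      (RPDG.error_bound hm hLf0 hR hε hB hlam hlam1 hq)
  have hint : ∀ F : E → ℝ, MeasureTheory.Integrable (fun w => F (A.output K fun t => i t w)) P :=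
    fun F => RPDG.integrable_of_dependsOn hi (RPDG.Execution.average_dependsOn A _ F K)
  constructor
  · intro hK
    obtain ⟨hmem, hE⟩ := hmain 1 one_pos le_rfl (by rwa [div_one])
    refine ⟨hmem, hint fun x => RPDG.objective f h ω 0 x - sInf (RPDG.objective f h ω 0 '' X), ?_⟩
    calc _ ≤ ∫ w, (RPDG.objective f (RPDG.perturbed h ω δ x₀ s₀) ω δ (A.output K fun t => i t w) -
          RPDG.objective f (RPDG.perturbed h ω δ x₀ s₀) ω δ u + ε / 2) ∂P := by
          refine MeasureTheory.integral_mono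
            (hint fun x => RPDG.objective f h ω 0 x - sInf (RPDG.objective f h ω 0 '' X))
            (hint fun x => RPDG.objective f (RPDG.perturbed h ω δ x₀ s₀) ω δ x -
              RPDG.objective f (RPDG.perturbed h ω δ x₀ s₀) ω δ u + ε / 2) fun w => ?_
          have := (hcomp _ (hmem fun t => i t w)).1
          simp only
          linarith
      _ ≤ ε := by
          rw [MeasureTheory.integral_add (hint fun x =>
            RPDG.objective f (RPDG.perturbed h ω δ x₀ s₀) ω δ x -
              RPDG.objective f (RPDG.perturbed h ω δ x₀ s₀) ω δ u)
            (MeasureTheory.integrable_const _), MeasureTheory.integral_const]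
          simp only [MeasureTheory.probReal_univ, smul_eq_mul]
          linarith
  · intro lam hlam hlam1 hK
    obtain ⟨hmem, hE⟩ := hmain lam hlam hlam1.le hK
    refine ⟨hmem, ?_⟩
    -- Markov's inequality is applied to the perturbed gap at level `ε / 2`; an original gap above
    -- `ε` forces the perturbed gap above that level.
    have hmarkov := MeasureTheory.mul_meas_ge_le_integral_of_nonneg (μ := P)
      (f := fun w => RPDG.objective f (RPDG.perturbed h ω δ x₀ s₀) ω δ
        (A.output K fun t => i t w) - RPDG.objective f (RPDG.perturbed h ω δ x₀ s₀) ω δ u)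
      (Filter.Eventually.of_forall fun w => sub_nonneg.2 (humin' _ (hmem fun t => i t w)))
      (hint fun x => RPDG.objective f (RPDG.perturbed h ω δ x₀ s₀) ω δ x -
        RPDG.objective f (RPDG.perturbed h ω δ x₀ s₀) ω δ u) (ε / 2)
    refine le_trans (MeasureTheory.measureReal_mono ?_)
      (le_of_mul_le_mul_left (hmarkov.trans hE) (half_pos hε))
    intro w hw
    have h1 := (hcomp _ (hmem fun t => i t w)).1
    simp only [Set.mem_ofPred_eq] at hw ⊢
    linarith
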